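/- Let $1<k\le \frac n2$ be integers. Let $C$ be the quiver with vertex set $\mathbb Z_n$ and arrows $x_i\colon i-1\to i$, $y_i\colon i\to i-1$ for $i\in\mathbb Z_n$, and let $B=B_{k,n}$ be the completion, with respect to the ideal generated by the arrows, of the quotient of the path algebra $\mathbb C C$ by the $2n$ relations $xy=yx$ and $x^k=y^{n-k}$ (one of each for every starting vertex). Modules are left $B$-modules, and $Z=\mathbb C[[t]]$ acts centrally on them through $t=\sum_i x_iy_i$. For a $k$-subset (rim) $I\subseteq\mathbb Z_n$ let $L_I$ be the $B$-module with $\mathbb C[[t]]$ at every vertex, where $x_i$ acts as multiplication by $1$ if $i\in I$ and by $t$ if $i\notin I$, and $y_i$ acts as multiplication by $t$ if $i\in I$ and by $1$ if $i\notin I$. A peak of $I$ is an $i\in\mathbb Z_n$ with $i\notin I$ and $i+1\in I$. The slopes of $I$ are the maximal cyclic intervals of $I$ (downward slopes) and of $\mathbb Z_n\setminus I$ (upward slopes), and the length of a slope is its number of elements. Let $\Omega(M)$ denote the first syzygy of $M$, that is, the kernel of a projective cover of $M$. Suppose that $I$ has exactly two peaks, and let $m$ be the minimum of the lengths of its four slopes.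 Then $L_I$ has a projective cover, and there is an isomorphism of $\mathbb C[[t]]$-modules $$\operatorname{Ext}^1_B(L_I,\Omega(L_I))\cong \mathbb C[[t]]/(t^m).$$ In particular, if some slope of $I$ has length $1$, then $$\operatorname{Ext}^1_B(L_I,\Omega(L_I))\cong\operatorname{Ext}^1_B(\Omega(L_I),L_I)\cong\mathbb C$$ as $\mathbb C[[t]]$-modules, where $t$ acts on $\mathbb C$ as $0$. -/

import Mathlib

open CategoryTheory
open scoped PowerSeries

set_option linter.unusedSectionVars false

noncomputable section

namespace CircularAlgebra

/-! ## The algebra -/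

/-- The vertex idempotents `e i` and the arrows `x i : i - 1 → i`, `y i : i → i - 1` of the doubled
cyclic quiver with vertex set `ℤ/n`. -/
inductive Gen (n : ℕ) : Type
  | e (i : ZMod n) : Gen n
  | x (i : ZMod n) : Gen n
  | y (i : ZMod n) : Gen n

/-- The free algebra on the vertices and arrows. -/
abbrev Free (n : ℕ) : Type := FreeAlgebra ℂ (Gen n)

def Free.e {n : ℕ} (i : ZMod n) : Free n := FreeAlgebra.ι ℂ (Gen.e i)
def Free.x {n : ℕ} (i : ZMod n) : Free n := FreeAlgebra.ι ℂ (Gen.x i)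
def Free.y {n : ℕ} (i : ZMod n) : Free n := FreeAlgebra.ι ℂ (Gen.y i)

/-- The relations. The first seven present the path algebra of the quiver (paths are composed from
right to left, so that representations of the quiver are left modules). The last two are the `2n`
relations `xy = yx` and `x ^ k = y ^ (n - k)`, one of each for every starting vertex `i`. -/
inductive Rel (k n : ℕ) [NeZero n] : Free n → Free n → Prop
  | idem (i : ZMod n) : Rel k n (Free.e i * Free.e i) (Free.e i)
  | orth (i j : ZMod n) (h : i ≠ j) : Rel k n (Free.e i * Free.e j) 0
  | sum_e : Rel k n (∑ i, Free.e i) 1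
  | x_target (i : ZMod n) : Rel k n (Free.e i * Free.x i) (Free.x i)
  | x_source (i : ZMod n) : Rel k n (Free.x i * Free.e (i - 1)) (Free.x i)
  | y_target (i : ZMod n) : Rel k n (Free.e (i - 1) * Free.y i) (Free.y i)
  | y_source (i : ZMod n) : Rel k n (Free.y i * Free.e i) (Free.y i)
  | comm (i : ZMod n) : Rel k n (Free.x i * Free.y i) (Free.y (i + 1) * Free.x (i + 1))
  | pow (i : ZMod n) :
      Rel k n ((∑ j, Free.x j) ^ k * Free.e i) ((∑ j, Free.y j) ^ (n - k) * Free.e i)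

/-- The quotient of the path algebra by the relations, before completion. -/
def PreB (k n : ℕ) [NeZero n] : Type := RingQuot (Rel k n)

instance (k n : ℕ) [NeZero n] : Ring (PreB k n) := inferInstanceAs (Ring (RingQuot (Rel k n)))
instance (k n : ℕ) [NeZero n] : Algebra ℂ (PreB k n) :=
  inferInstanceAs (Algebra ℂ (RingQuot (Rel k n)))

section

variable {k n : ℕ} [NeZero n]

/-- The quotient map. -/
def PreB.mk : Free n →ₐ[ℂ] PreB k n := RingQuot.mkAlgHom ℂ (Rel k n)

def PreB.e (i : ZMod n) : PreB k n := PreB.mk (Free.e i)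
def PreB.x (i : ZMod n) : PreB k n := PreB.mk (Free.x i)
def PreB.y (i : ZMod n) : PreB k n := PreB.mk (Free.y i)

theorem PreB.mk_surjective : Function.Surjective (PreB.mk : Free n →ₐ[ℂ] PreB k n) :=
  RingQuot.mkAlgHom_surjective ℂ (Rel k n)

theorem PreB.mk_rel {a b : Free n} (h : Rel k n a b) : (PreB.mk a : PreB k n) = PreB.mk b :=
  RingQuot.mkAlgHom_rel ℂ h

theorem PreB.e_mul_e (i : ZMod n) : (PreB.e i * PreB.e i : PreB k n) = PreB.e i := by
  simpa [PreB.e] using PreB.mk_rel (k := k) (Rel.idem i)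

theorem PreB.e_mul_e_ne (i j : ZMod n) (h : i ≠ j) : (PreB.e i * PreB.e j : PreB k n) = 0 := by
  simpa [PreB.e] using PreB.mk_rel (k := k) (Rel.orth i j h)

theorem PreB.e_mul_x (i : ZMod n) : (PreB.e i * PreB.x i : PreB k n) = PreB.x i := by
  simpa [PreB.e, PreB.x] using PreB.mk_rel (k := k) (Rel.x_target i)

theorem PreB.x_mul_e (i : ZMod n) : (PreB.x i * PreB.e (i - 1) : PreB k n) = PreB.x i := by
  simpa [PreB.e, PreB.x] using PreB.mk_rel (k := k) (Rel.x_source i)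

theorem PreB.e_mul_y (i : ZMod n) : (PreB.e (i - 1) * PreB.y i : PreB k n) = PreB.y i := by
  simpa [PreB.e, PreB.y] using PreB.mk_rel (k := k) (Rel.y_target i)

theorem PreB.y_mul_e (i : ZMod n) : (PreB.y i * PreB.e i : PreB k n) = PreB.y i := by
  simpa [PreB.e, PreB.y] using PreB.mk_rel (k := k) (Rel.y_source i)

theorem PreB.x_mul_y (i : ZMod n) :
    (PreB.x i * PreB.y i : PreB k n) = PreB.y (i + 1) * PreB.x (i + 1) := by
  simpa [PreB.x, PreB.y] using PreB.mk_rel (k := k) (Rel.comm i)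

theorem PreB.induction {P : PreB k n → Prop} (hc : ∀ c : ℂ, P (algebraMap ℂ (PreB k n) c))
    (he : ∀ i, P (PreB.e i)) (hx : ∀ i, P (PreB.x i)) (hy : ∀ i, P (PreB.y i))
    (hadd : ∀ a b, P a → P b → P (a + b)) (hmul : ∀ a b, P a → P b → P (a * b)) (a : PreB k n) :
    P a := by
  obtain ⟨a, rfl⟩ := PreB.mk_surjective a
  induction a using FreeAlgebra.induction with
  | grade0 r => simpa using hc r
  | grade1 g =>
    cases g with
    | e i => exact he i
    | x i => exact hx i
    | y i => exact hy i
  | mul a b ha hb => rw [map_mul]; exact hmul _ _ ha hb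
  | add a b ha hb => rw [map_add]; exact hadd _ _ ha hb

/-- The element `t = ∑ xᵢ yᵢ`. -/
def PreB.t : PreB k n := ∑ i, PreB.x i * PreB.y i

theorem PreB.e_mul_t (j : ZMod n) : (PreB.e j * PreB.t : PreB k n) = PreB.x j * PreB.y j := by
  rw [PreB.t, Finset.mul_sum, Finset.sum_eq_single j]
  · rw [← mul_assoc, PreB.e_mul_x]
  · intro i _ hi
    rw [← PreB.e_mul_x i, ← mul_assoc, ← mul_assoc, PreB.e_mul_e_ne _ _ hi.symm, zero_mul, zero_mul]
  · simp

theorem PreB.t_mul_e (j : ZMod n) : (PreB.t * PreB.e j : PreB k n) = PreB.x j * PreB.y j := by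
  rw [PreB.t, Finset.sum_mul, Finset.sum_eq_single j]
  · rw [mul_assoc, PreB.y_mul_e]
  · intro i _ hi
    rw [← PreB.y_mul_e i, mul_assoc, mul_assoc, PreB.e_mul_e_ne _ _ hi, mul_zero, mul_zero]
  · simp

theorem PreB.t_comm (a : PreB k n) : PreB.t * a = a * PreB.t := by
  induction a using PreB.induction with
  | hc c => exact (Algebra.commutes c _).symm
  | he i => rw [PreB.e_mul_t, PreB.t_mul_e]
  | hx i =>
    have h := PreB.x_mul_y (k := k) (i - 1)
    rw [sub_add_cancel] at h
    conv_lhs => rw [← PreB.e_mul_x i, ← mul_assoc, PreB.t_mul_e]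
    conv_rhs => rw [← PreB.x_mul_e i, mul_assoc, PreB.e_mul_t, h]
    rw [mul_assoc]
  | hy i =>
    have h := PreB.x_mul_y (k := k) (i - 1)
    rw [sub_add_cancel] at h
    conv_lhs => rw [← PreB.e_mul_y i, ← mul_assoc, PreB.t_mul_e, h]
    conv_rhs => rw [← PreB.y_mul_e i, mul_assoc, PreB.e_mul_t]
    rw [mul_assoc]
  | hadd a b ha hb => rw [mul_add, add_mul, ha, hb]
  | hmul a b ha hb => rw [← mul_assoc, ha, mul_assoc, hb, mul_assoc]

end

/-- The two-sided ideal generated by the arrows. -/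
def arrowIdeal (k n : ℕ) [NeZero n] : Ideal (PreB k n) :=
  TwoSidedIdeal.asIdeal
    (TwoSidedIdeal.span (Set.range PreB.x ∪ Set.range PreB.y : Set (PreB k n)))

instance (k n : ℕ) [NeZero n] : (arrowIdeal k n).IsTwoSided :=
  inferInstanceAs (TwoSidedIdeal.asIdeal _).IsTwoSided

/-- The inverse limit of the quotients by the powers of the arrow ideal: the coherent sequences. -/
def completion (k n : ℕ) [NeZero n] : Subring (∀ j : ℕ, PreB k n ⧸ arrowIdeal k n ^ j) where
  carrier := {b | ∀ ⦃i j : ℕ⦄ (h : i ≤ j), Ideal.Quotient.factor (Ideal.pow_le_pow_right h) (b j) = b i}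
  mul_mem' ha hb i j h := by simp [ha h, hb h]
  one_mem' i j h := by simp
  add_mem' ha hb i j h := by simp [ha h, hb h]
  zero_mem' i j h := by simp
  neg_mem' ha i j h := by simp [ha h]

/-- The algebra `B_{k,n}`: the completion of `PreB k n` with respect to the arrow ideal. -/
def B (k n : ℕ) [NeZero n] : Type := completion k n

instance (k n : ℕ) [NeZero n] : Ring (B k n) := inferInstanceAs (Ring (completion k n))

section

variable {k n : ℕ} [NeZero n]

/-- The `j`-th component of an element of the completion. -/
def B.comp (j : ℕ) : B k n →+* PreB k n ⧸ arrowIdeal k n ^ j :=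
  (Pi.evalRingHom _ j).comp (completion k n).subtype

@[ext] theorem B.ext {a b : B k n} (h : ∀ j, B.comp j a = B.comp j b) : a = b :=
  Subtype.ext (funext h)

theorem B.comp_factor (b : B k n) {i j : ℕ} (h : i ≤ j) :
    Ideal.Quotient.factor (Ideal.pow_le_pow_right h) (B.comp j b) = B.comp i b := b.2 h

/-- The canonical map to the completion. -/
def B.of : PreB k n →+* B k n :=
  (RingHom.pi fun j => Ideal.Quotient.mk (arrowIdeal k n ^ j)).codRestrict (completion k n)
    (fun a _ _ h => Ideal.Quotient.factor_mk (Ideal.pow_le_pow_right h) a)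

@[simp] theorem B.comp_of (j : ℕ) (a : PreB k n) :
    B.comp j (B.of a) = Ideal.Quotient.mk (arrowIdeal k n ^ j) a := rfl

/-! ## The central power series ring -/

theorem x_mem (i : ZMod n) : (PreB.x i : PreB k n) ∈ arrowIdeal k n :=
  TwoSidedIdeal.subset_span (Or.inl ⟨i, rfl⟩)

theorem y_mem (i : ZMod n) : (PreB.y i : PreB k n) ∈ arrowIdeal k n :=
  TwoSidedIdeal.subset_span (Or.inr ⟨i, rfl⟩)

theorem t_mem : (PreB.t : PreB k n) ∈ arrowIdeal k n :=
  Ideal.sum_mem _ fun i _ => Ideal.mul_mem_left _ _ (y_mem i)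

theorem t_pow_mem {i j : ℕ} (h : i ≤ j) : (PreB.t : PreB k n) ^ j ∈ arrowIdeal k n ^ i :=
  Ideal.pow_le_pow_right h (Ideal.pow_mem_pow t_mem j)

/-- The partial sum `∑_{c < j} f_c t ^ c`. -/
def partialSum (f : ℂ⟦X⟧) (j : ℕ) : PreB k n :=
  Polynomial.aeval PreB.t (PowerSeries.trunc j f)

theorem aeval_mem {j : ℕ} {p : Polynomial ℂ} (h : Polynomial.X ^ j ∣ p) :
    Polynomial.aeval (PreB.t : PreB k n) p ∈ arrowIdeal k n ^ j := by
  obtain ⟨q, rfl⟩ := h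
  rw [mul_comm, map_mul, map_pow, Polynomial.aeval_X]
  exact Ideal.mul_mem_left _ _ (t_pow_mem le_rfl)

theorem mk_aeval_eq {j : ℕ} {p q : Polynomial ℂ} (h : ∀ c < j, p.coeff c = q.coeff c) :
    Ideal.Quotient.mk (arrowIdeal k n ^ j) (Polynomial.aeval PreB.t p) =
      Ideal.Quotient.mk (arrowIdeal k n ^ j) (Polynomial.aeval PreB.t q) := by
  rw [Ideal.Quotient.mk_eq_mk_iff_sub_mem, ← map_sub]
  refine aeval_mem (Polynomial.X_pow_dvd_iff.2 fun c hc => ?_)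
  rw [Polynomial.coeff_sub, h c hc, sub_self]

/-- The embedding of `ℂ⟦t⟧` into `B`, sending `f` to `∑ f_c t ^ c`. -/
def ofPowerSeries (k n : ℕ) [NeZero n] : ℂ⟦X⟧ →+* B k n :=
  RingHom.codRestrict (RingHom.pi fun j =>
    { toFun := fun f => Ideal.Quotient.mk (arrowIdeal k n ^ j) (partialSum f j)
      map_one' := by
        rw [← map_one (Ideal.Quotient.mk _), partialSum, ← map_one (Polynomial.aeval (R := ℂ) (PreB.t : PreB k n))]
        refine mk_aeval_eq fun c hc => ?_
        simp [PowerSeries.coeff_trunc, hc, Polynomial.coeff_one, PowerSeries.coeff_one]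
      map_zero' := by simp [partialSum]
      map_add' := fun f g => by simp [partialSum]
      map_mul' := fun f g => by
        rw [← map_mul, partialSum, partialSum, partialSum, ← map_mul]
        refine mk_aeval_eq fun c hc => ?_
        rw [PowerSeries.coeff_trunc, if_pos hc, Polynomial.coeff_mul, PowerSeries.coeff_mul]
        refine Finset.sum_congr rfl fun p hp => ?_
        have : p.1 + p.2 = c := by simpa using hp
        rw [PowerSeries.coeff_trunc, PowerSeries.coeff_trunc, if_pos (by omega),
          if_pos (by omega)] }) (completion k n) (fun f i j h => by
    refine (Ideal.Quotient.factor_mk (Ideal.pow_le_pow_right h) (partialSum f j)).trans ?_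
    change _ = Ideal.Quotient.mk (arrowIdeal k n ^ i) (partialSum f i)
    rw [partialSum, partialSum]
    refine mk_aeval_eq fun c hc => ?_
    rw [PowerSeries.coeff_trunc, PowerSeries.coeff_trunc, if_pos (by omega), if_pos hc])

theorem comp_ofPowerSeries (f : ℂ⟦X⟧) (j : ℕ) :
    B.comp j (ofPowerSeries k n f) = Ideal.Quotient.mk _ (partialSum f j) := rfl

theorem ofPowerSeries_X : ofPowerSeries k n PowerSeries.X = B.of PreB.t := by
  ext j
  rw [comp_ofPowerSeries, B.comp_of, partialSum]
  conv_rhs => rw [← Polynomial.aeval_X (R := ℂ) (PreB.t : PreB k n)]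
  refine mk_aeval_eq fun c hc => ?_
  simp [PowerSeries.coeff_trunc, hc, Polynomial.coeff_X, PowerSeries.coeff_X, eq_comm]

theorem ofPowerSeries_comm (f : ℂ⟦X⟧) (b : B k n) :
    ofPowerSeries k n f * b = b * ofPowerSeries k n f := by
  ext j
  obtain ⟨a, ha⟩ := Ideal.Quotient.mk_surjective (B.comp j b)
  rw [map_mul, map_mul, comp_ofPowerSeries, ← ha, ← map_mul, ← map_mul]
  congr 1
  rw [partialSum]
  generalize PowerSeries.trunc j f = p
  induction p using Polynomial.induction_on' with
  | add p q hp hq => rw [map_add, add_mul, mul_add, hp, hq]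
  | monomial m c =>
    rw [Polynomial.aeval_monomial, mul_assoc,
      (show Commute (PreB.t ^ m) a from Commute.pow_left (PreB.t_comm a) m).eq,
      ← mul_assoc, Algebra.commutes, mul_assoc]

end

/-- `B` is an algebra over `Z = ℂ⟦t⟧`, with `t = ∑ xᵢ yᵢ`. -/
instance (k n : ℕ) [NeZero n] : Algebra ℂ⟦X⟧ (B k n) :=
  (ofPowerSeries k n).toAlgebra' ofPowerSeries_comm

/-- The category of left `B`-modules is `Z`-linear: a power series acts on morphisms through its
(central) image in `B`. -/
instance (k n : ℕ) [NeZero n] : Linear ℂ⟦X⟧ (ModuleCat.{0} (B k n)) where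
  homModule M N :=
    letI : Module ℂ⟦X⟧ N := Module.compHom N (algebraMap ℂ⟦X⟧ (B k n))
    haveI : SMulCommClass (B k n) ℂ⟦X⟧ N := ⟨fun b f v => by
      change b • (algebraMap ℂ⟦X⟧ (B k n) f) • v = (algebraMap ℂ⟦X⟧ (B k n) f) • b • v
      rw [← mul_smul, ← mul_smul, Algebra.commutes]⟩
    inferInstance
  smul_comp M N P f g h := by
    ext v
    exact map_smul h.hom (algebraMap ℂ⟦X⟧ (B k n) f) (g.hom v)
  comp_smul M N P g f h := by
    ext v
    rfl

/-! ## The rank one modules -/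

section

variable {n : ℕ} [NeZero n] (I : Finset (ZMod n))

/-- The space `⨁ᵢ Uᵢ` with `Uᵢ = ℂ⟦t⟧`. -/
abbrev Lattice (n : ℕ) : Type := ZMod n → ℂ⟦X⟧

/-- The coefficient of `xᵢ`: `1` if `i ∈ I`, and `t` otherwise. -/
def xCoeff (i : ZMod n) : ℂ⟦X⟧ := if i ∈ I then 1 else PowerSeries.X

/-- The coefficient of `yᵢ`: `t` if `i ∈ I`, and `1` otherwise. -/
def yCoeff (i : ZMod n) : ℂ⟦X⟧ := if i ∈ I then PowerSeries.X else 1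

/-- The projection to `Uᵢ`. -/
def eMap (i : ZMod n) : Module.End ℂ⟦X⟧ (Lattice n) :=
  LinearMap.single ℂ⟦X⟧ (fun _ => ℂ⟦X⟧) i ∘ₗ LinearMap.proj i

/-- Multiplication by `xCoeff I i` from `Uᵢ₋₁` to `Uᵢ`. -/
def xMap (i : ZMod n) : Module.End ℂ⟦X⟧ (Lattice n) :=
  LinearMap.single ℂ⟦X⟧ (fun _ => ℂ⟦X⟧) i ∘ₗ (xCoeff I i • LinearMap.proj (i - 1))

/-- Multiplication by `yCoeff I i` from `Uᵢ` to `Uᵢ₋₁`. -/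
def yMap (i : ZMod n) : Module.End ℂ⟦X⟧ (Lattice n) :=
  LinearMap.single ℂ⟦X⟧ (fun _ => ℂ⟦X⟧) (i - 1) ∘ₗ (yCoeff I i • LinearMap.proj i)

theorem eMap_apply (i : ZMod n) (v : Lattice n) : eMap i v = Pi.single i (v i) := rfl

theorem xMap_apply (i : ZMod n) (v : Lattice n) :
    xMap I i v = Pi.single i (xCoeff I i * v (i - 1)) := rfl

theorem yMap_apply (i : ZMod n) (v : Lattice n) :
    yMap I i v = Pi.single (i - 1) (yCoeff I i * v i) := rfl

theorem xCoeff_mul_yCoeff (i : ZMod n) : xCoeff I i * yCoeff I i = PowerSeries.X := by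
  unfold xCoeff yCoeff; split_ifs <;> simp

theorem sum_xMap_apply (v : Lattice n) (i : ZMod n) :
    (∑ j, xMap I j) v i = xCoeff I i * v (i - 1) := by
  rw [LinearMap.sum_apply, Finset.sum_apply, Finset.sum_eq_single i]
  · simp [xMap_apply]
  · intro j _ hj
    simp [xMap_apply, Pi.single_eq_of_ne hj.symm]
  · simp

theorem sum_yMap_apply (v : Lattice n) (i : ZMod n) :
    (∑ j, yMap I j) v i = yCoeff I (i + 1) * v (i + 1) := by
  rw [LinearMap.sum_apply, Finset.sum_apply, Finset.sum_eq_single (i + 1)]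
  · rw [yMap_apply, add_sub_cancel_right, Pi.single_eq_same]
  · intro j _ hj
    rw [yMap_apply, Pi.single_eq_of_ne]
    rintro rfl
    simp at hj
  · simp

theorem sum_xMap_mul_sum_yMap :
    (∑ j, xMap I j) * (∑ j, yMap I j) = (PowerSeries.X : ℂ⟦X⟧) • (1 : Module.End ℂ⟦X⟧ (Lattice n)) := by
  refine LinearMap.ext fun v => ?_
  funext i
  rw [Module.End.mul_apply, sum_xMap_apply, sum_yMap_apply, sub_add_cancel, ← mul_assoc,
    xCoeff_mul_yCoeff]
  rfl

theorem sum_yMap_mul_sum_xMap :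
    (∑ j, yMap I j) * (∑ j, xMap I j) = (PowerSeries.X : ℂ⟦X⟧) • (1 : Module.End ℂ⟦X⟧ (Lattice n)) := by
  refine LinearMap.ext fun v => ?_
  funext i
  rw [Module.End.mul_apply, sum_yMap_apply, sum_xMap_apply, add_sub_cancel_right, ← mul_assoc,
    mul_comm (yCoeff I _), xCoeff_mul_yCoeff]
  rfl

theorem sum_xMap_pow_apply (m : ℕ) (v : Lattice n) (i : ZMod n) :
    ((∑ j, xMap I j) ^ m) v i = (∏ s ∈ Finset.range m, xCoeff I (i - s)) * v (i - m) := by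
  induction m generalizing i with
  | zero => simp
  | succ m ih =>
    rw [pow_succ', Module.End.mul_apply, sum_xMap_apply, ih, Finset.prod_range_succ', ← mul_assoc]
    have h1 : i - 1 - (m : ZMod n) = i - ((m + 1 : ℕ) : ZMod n) := by push_cast; ring
    rw [h1, mul_comm (xCoeff I i)]
    congr 2
    · refine Finset.prod_congr rfl fun s _ => ?_
      congr 1
      push_cast
      ring
    · simp

theorem prod_range_eq {M : Type*} [CommMonoid M] (f : ZMod n → M) :
    ∏ s ∈ Finset.range n, f s = ∏ i, f i := by
  refine Finset.prod_bij' (fun s _ => (s : ZMod n)) (fun i _ => i.val) ?_ ?_ ?_ ?_ ?_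
  · simp
  · intro i _
    exact Finset.mem_range.2 (ZMod.val_lt i)
  · intro s hs
    exact ZMod.val_cast_of_lt (Finset.mem_range.1 hs)
  · intro i _
    exact ZMod.natCast_zmod_val i
  · simp

theorem sum_xMap_pow_card : (∑ j, xMap I j) ^ n =
    (PowerSeries.X ^ (n - I.card) : ℂ⟦X⟧) • (1 : Module.End ℂ⟦X⟧ (Lattice n)) := by
  refine LinearMap.ext fun v => ?_
  funext i
  rw [sum_xMap_pow_apply, prod_range_eq (fun s => xCoeff I (i - s)), ZMod.natCast_self, sub_zero,
    Fintype.prod_equiv (Equiv.subLeft i) (fun s => xCoeff I (i - s)) (xCoeff I) (fun _ => rfl)]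
  have : ∏ j, xCoeff I j = (PowerSeries.X : ℂ⟦X⟧) ^ (n - I.card) := by
    unfold xCoeff
    rw [Finset.prod_ite, Finset.prod_const_one, one_mul, Finset.prod_const]
    congr 1
    rw [← Finset.compl_filter, Finset.card_compl, ZMod.card]
    simp
  rw [this]
  rfl

theorem sum_xMap_pow_eq {k : ℕ} (hI : I.card = k) :
    (∑ j, xMap I j) ^ k = (∑ j, yMap I j) ^ (n - k) := by
  have hkn : k ≤ n := by
    have := Finset.card_le_univ I
    rwa [ZMod.card, hI] at this
  have hc : Commute (∑ j, yMap I j) (∑ j, xMap I j) := by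
    rw [Commute, SemiconjBy, sum_yMap_mul_sum_xMap, sum_xMap_mul_sum_yMap]
  have hyx : (∑ j, yMap I j) ^ (n - k) * (∑ j, xMap I j) ^ (n - k) =
      (PowerSeries.X ^ (n - k) : ℂ⟦X⟧) • (1 : Module.End ℂ⟦X⟧ (Lattice n)) := by
    rw [← hc.mul_pow, sum_yMap_mul_sum_xMap, smul_pow, one_pow]
  have hxx : (∑ j, xMap I j) ^ k * (∑ j, xMap I j) ^ (n - k) =
      (PowerSeries.X ^ (n - k) : ℂ⟦X⟧) • (1 : Module.End ℂ⟦X⟧ (Lattice n)) := by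
    rw [← pow_add, Nat.add_sub_cancel' hkn, sum_xMap_pow_card, hI]
  have hxy : (∑ j, xMap I j) ^ (n - k) * (∑ j, yMap I j) ^ (n - k) =
      (PowerSeries.X ^ (n - k) : ℂ⟦X⟧) • (1 : Module.End ℂ⟦X⟧ (Lattice n)) := by
    rw [← hc.symm.mul_pow, sum_xMap_mul_sum_yMap, smul_pow, one_pow]
  have h := congrArg (· * (∑ j, yMap I j) ^ (n - k)) (hxx.trans hyx.symm)
  simp only [mul_assoc, hxy, mul_smul_comm, mul_one] at h
  refine LinearMap.ext fun v => ?_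
  funext i
  have h2 := congrFun (LinearMap.congr_fun h v) i
  exact mul_left_cancel₀ (pow_ne_zero _ PowerSeries.X_ne_zero) h2

/-- The values of the generators on the representation. -/
def genMap : Gen n → Module.End ℂ⟦X⟧ (Lattice n)
  | .e i => eMap i
  | .x i => xMap I i
  | .y i => yMap I i

def freeRep : Free n →ₐ[ℂ] Module.End ℂ⟦X⟧ (Lattice n) := FreeAlgebra.lift ℂ (genMap I)

theorem freeRep_e (i : ZMod n) : freeRep I (Free.e i) = eMap i := FreeAlgebra.lift_ι_apply _ _
theorem freeRep_x (i : ZMod n) : freeRep I (Free.x i) = xMap I i := FreeAlgebra.lift_ι_apply _ _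
theorem freeRep_y (i : ZMod n) : freeRep I (Free.y i) = yMap I i := FreeAlgebra.lift_ι_apply _ _

theorem freeRep_rel {k : ℕ} (hI : I.card = k) ⦃a b : Free n⦄ (h : Rel k n a b) :
    freeRep I a = freeRep I b := by
  cases h with
  | idem i =>
    refine LinearMap.ext fun v => ?_; simp [freeRep_e, eMap_apply]
  | orth i j h =>
    refine LinearMap.ext fun v => ?_; simp [freeRep_e, eMap_apply, Pi.single_eq_of_ne h]
  | sum_e =>
    refine LinearMap.ext fun v => ?_
    simp only [map_sum, freeRep_e, LinearMap.sum_apply, eMap_apply, map_one, Module.End.one_apply]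
    exact Finset.univ_sum_single v
  | x_target i => refine LinearMap.ext fun v => ?_; simp [freeRep_e, freeRep_x, eMap_apply, xMap_apply]
  | x_source i => refine LinearMap.ext fun v => ?_; simp [freeRep_e, freeRep_x, eMap_apply, xMap_apply]
  | y_target i => refine LinearMap.ext fun v => ?_; simp [freeRep_e, freeRep_y, eMap_apply, yMap_apply]
  | y_source i => refine LinearMap.ext fun v => ?_; simp [freeRep_e, freeRep_y, eMap_apply, yMap_apply]
  | comm i =>
    refine LinearMap.ext fun v => ?_
    simp only [map_mul, freeRep_x, freeRep_y, Module.End.mul_apply, xMap_apply, yMap_apply,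
      Pi.single_eq_same, add_sub_cancel_right, ← mul_assoc, xCoeff_mul_yCoeff]
    rw [mul_comm (yCoeff I _), xCoeff_mul_yCoeff]
  | pow i =>
    simp only [map_mul, map_pow, map_sum, freeRep_x, freeRep_y]
    rw [sum_xMap_pow_eq I hI]

/-- The representation of the uncompleted algebra. -/
def preRep {k : ℕ} (hI : I.card = k) : PreB k n →ₐ[ℂ] Module.End ℂ⟦X⟧ (Lattice n) :=
  RingQuot.liftAlgHom ℂ ⟨freeRep I, freeRep_rel I hI⟩

theorem preRep_mk {k : ℕ} (hI : I.card = k) (a : Free n) :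
    preRep I hI (PreB.mk a) = freeRep I a :=
  RingQuot.liftAlgHom_mkAlgHom_apply ℂ _ _ _

/-! The action extends to the completion, because high powers of the arrow ideal act with high
`t`-adic order. This is measured by a filtration of the lattice on which every arrow has degree at
least one. -/

/-- The change of height along the edge `i`. -/
def slopeStep (i : ZMod n) : ℤ := (if i ∈ I then (n : ℤ) else 0) - I.card

/-- The height of the vertex `i`, starting from height `0` at the vertex `0`. -/
def height (i : ZMod n) : ℤ := ∑ s ∈ Finset.range i.val, slopeStep I ((s + 1 : ℕ) : ZMod n)

theorem sum_slopeStep : ∑ s ∈ Finset.range n, slopeStep I ((s + 1 : ℕ) : ZMod n) = 0 := by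
  have h1 := prod_range_eq (M := Multiplicative ℤ)
    (fun i : ZMod n => Multiplicative.ofAdd (slopeStep I (i + 1)))
  have h2 : ∑ s ∈ Finset.range n, slopeStep I ((s : ZMod n) + 1) = ∑ i, slopeStep I (i + 1) := h1
  push_cast
  rw [h2, Fintype.sum_equiv (Equiv.addRight (1 : ZMod n)) (fun i => slopeStep I (i + 1))
    (slopeStep I) (fun _ => rfl)]
  unfold slopeStep
  rw [Finset.sum_sub_distrib, Finset.sum_ite_mem]
  simp [ZMod.card, mul_comm]

theorem height_eq (i : ZMod n) : height I i = height I (i - 1) + slopeStep I i := by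
  have key : ∀ j : ZMod n, height I (j + 1) = height I j + slopeStep I (j + 1) := by
    intro j
    have hs : height I j + slopeStep I (j + 1) =
        ∑ s ∈ Finset.range (j.val + 1), slopeStep I ((s + 1 : ℕ) : ZMod n) := by
      rw [Finset.sum_range_succ, height]
      simp
    rw [hs]
    by_cases h : j.val + 1 < n
    · have : (j + 1).val = j.val + 1 := by
        have h3 : ((j.val + 1 : ℕ) : ZMod n) = j + 1 := by simp
        rw [← h3, ZMod.val_cast_of_lt h]
      rw [height, this]
    · have h2 : j.val + 1 = n := by
        have := ZMod.val_lt j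
        omega
      have h3 : j + 1 = 0 := by
        have h4 : ((j.val + 1 : ℕ) : ZMod n) = j + 1 := by simp
        rw [← h4, h2, ZMod.natCast_self]
      rw [h2, sum_slopeStep, h3]
      simp [height]
  have := key (i - 1)
  rwa [sub_add_cancel] at this

theorem abs_height_le (i : ZMod n) : |height I i| ≤ (n : ℤ) ^ 2 := by
  have hc : I.card ≤ n := by
    have := Finset.card_le_univ I
    rwa [ZMod.card] at this
  refine (Finset.abs_sum_le_sum_abs _ _).trans ?_
  refine (Finset.sum_le_card_nsmul _ _ (n : ℤ) fun s _ => ?_).trans ?_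
  · unfold slopeStep
    rw [abs_le]
    split_ifs <;> constructor <;> omega
  · have := (ZMod.val_lt i).le
    rw [Finset.card_range, nsmul_eq_mul, sq]
    gcongr

/-- The vectors of filtration degree at least `s`, where the basis vector `t ^ c` at the vertex `i`
has degree `n * c + height i`. -/
def InFil (s : ℤ) (v : Lattice n) : Prop :=
  ∀ (i : ZMod n) (c : ℕ), (n : ℤ) * c + height I i < s → PowerSeries.coeff c (v i) = 0

theorem inFil_eMap {s : ℤ} {v : Lattice n} (h : InFil I s v) (j : ZMod n) :
    InFil I s (eMap j v) := by
  intro i c hc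
  rw [eMap_apply]
  by_cases hi : i = j
  · subst hi
    rw [Pi.single_eq_same]
    exact h i c hc
  · rw [Pi.single_eq_of_ne hi, map_zero]

theorem inFil_xMap {s : ℤ} {v : Lattice n} (hn : I.card < n) (h : InFil I s v) (j : ZMod n) :
    InFil I (s + 1) (xMap I j v) := by
  intro i c hc
  rw [xMap_apply]
  by_cases hi : i = j
  · subst hi
    rw [Pi.single_eq_same]
    have hh := height_eq I i
    unfold slopeStep at hh
    unfold xCoeff
    split_ifs at hh ⊢
    · rw [one_mul]
      exact h _ _ (by omega)
    · cases c with
      | zero => simp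
      | succ c =>
        rw [PowerSeries.coeff_succ_X_mul]
        refine h _ _ ?_
        push_cast at hc
        rw [mul_add] at hc
        omega
  · rw [Pi.single_eq_of_ne hi, map_zero]

theorem inFil_yMap {s : ℤ} {v : Lattice n} (h0 : 0 < I.card) (h : InFil I s v) (j : ZMod n) :
    InFil I (s + 1) (yMap I j v) := by
  intro i c hc
  rw [yMap_apply]
  by_cases hi : i = j - 1
  · subst hi
    rw [Pi.single_eq_same]
    have hh := height_eq I j
    unfold slopeStep at hh
    unfold yCoeff
    split_ifs at hh ⊢
    · cases c with
      | zero => simp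
      | succ c =>
        rw [PowerSeries.coeff_succ_X_mul]
        refine h _ _ ?_
        push_cast at hc
        rw [mul_add] at hc
        omega
    · rw [one_mul]
      exact h _ _ (by omega)
  · rw [Pi.single_eq_of_ne hi, map_zero]

theorem InFil.add {s : ℤ} {v w : Lattice n} (hv : InFil I s v) (hw : InFil I s w) :
    InFil I s (v + w) := by
  intro i c hc
  rw [Pi.add_apply, map_add, hv i c hc, hw i c hc, add_zero]

theorem InFil.neg {s : ℤ} {v : Lattice n} (hv : InFil I s v) : InFil I s (-v) := by
  intro i c hc
  rw [Pi.neg_apply, map_neg, hv i c hc, neg_zero]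

theorem InFil.mono {s s' : ℤ} {v : Lattice n} (hv : InFil I s v) (h : s' ≤ s) : InFil I s' v :=
  fun i c hc => hv i c (hc.trans_le h)

theorem preRep_e {k : ℕ} (hI : I.card = k) (i : ZMod n) : preRep I hI (PreB.e i) = eMap i := by
  rw [PreB.e, preRep_mk, freeRep_e]

theorem preRep_x {k : ℕ} (hI : I.card = k) (i : ZMod n) : preRep I hI (PreB.x i) = xMap I i := by
  rw [PreB.x, preRep_mk, freeRep_x]

theorem preRep_y {k : ℕ} (hI : I.card = k) (i : ZMod n) : preRep I hI (PreB.y i) = yMap I i := by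
  rw [PreB.y, preRep_mk, freeRep_y]

theorem inFil_preRep {k : ℕ} (hI : I.card = k) (hk : 0 < k) (hkn : k < n) (a : PreB k n)
    {s : ℤ} {v : Lattice n} (hv : InFil I s v) : InFil I s (preRep I hI a v) := by
  induction a using PreB.induction generalizing v with
  | hc r =>
    rw [AlgHom.commutes]
    intro i c hc
    change PowerSeries.coeff c (r • v i) = 0
    rw [PowerSeries.coeff_smul, hv i c hc, smul_zero]
  | he i => rw [preRep_e]; exact inFil_eMap I hv i
  | hx i => rw [preRep_x]; exact (inFil_xMap I (by omega) hv i).mono I (by omega)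
  | hy i => rw [preRep_y]; exact (inFil_yMap I (by omega) hv i).mono I (by omega)
  | hadd a b ha hb => rw [map_add]; exact (ha hv).add I (hb hv)
  | hmul a b ha hb => rw [map_mul]; exact ha (hb hv)

theorem inFil_preRep_arrow {k : ℕ} (hI : I.card = k) (hk : 0 < k) (hkn : k < n) {a : PreB k n}
    (ha : a ∈ arrowIdeal k n) {s : ℤ} {v : Lattice n} (hv : InFil I s v) :
    InFil I (s + 1) (preRep I hI a v) := by
  have ha' : a ∈ TwoSidedIdeal.span
      (Set.range PreB.x ∪ Set.range PreB.y : Set (PreB k n)) := ha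
  clear ha
  induction ha' using TwoSidedIdeal.span_induction generalizing s v with
  | mem a h =>
    rcases h with ⟨i, rfl⟩ | ⟨i, rfl⟩
    · rw [preRep_x]; exact inFil_xMap I (by omega) hv i
    · rw [preRep_y]; exact inFil_yMap I (by omega) hv i
  | zero => rw [map_zero]; intro i c _; simp
  | add a b ha hb iha ihb => rw [map_add]; exact (iha hv).add I (ihb hv)
  | neg a ha iha => rw [map_neg]; exact (iha hv).neg I
  | left_absorb a b hb ihb =>
    rw [map_mul]
    exact inFil_preRep I hI hk hkn a (ihb hv)
  | right_absorb b a ha iha =>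
    rw [map_mul]
    exact iha (inFil_preRep I hI hk hkn b hv)

theorem inFil_preRep_pow {k : ℕ} (hI : I.card = k) (hk : 0 < k) (hkn : k < n) {j : ℕ}
    {a : PreB k n} (ha : a ∈ arrowIdeal k n ^ j) {s : ℤ} {v : Lattice n} (hv : InFil I s v) :
    InFil I (s + j) (preRep I hI a v) := by
  induction j generalizing a s v with
  | zero => simpa using inFil_preRep I hI hk hkn a hv
  | succ j ih =>
    rw [Submodule.pow_succ] at ha
    induction ha using Submodule.mul_induction_on' with
    | mem_mul_mem a ha b hb =>
      rw [map_mul]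
      have := ih ha (inFil_preRep_arrow I hI hk hkn hb hv)
      refine this.mono I ?_
      push_cast
      omega
    | add a ha b hb iha ihb => rw [map_add]; exact iha.add I ihb

/-- A power of the arrow ideal that acts with `t`-adic order larger than `c`. -/
def level (n c : ℕ) : ℕ := n * c + 2 * n ^ 2 + 1

theorem level_mono (n : ℕ) {c d : ℕ} (h : c ≤ d) : level n c ≤ level n d := by
  unfold level
  gcongr

theorem coeff_preRep_eq_zero {k : ℕ} (hI : I.card = k) (hk : 0 < k) (hkn : k < n) {c j : ℕ}
    (hj : level n c ≤ j) {a : PreB k n} (ha : a ∈ arrowIdeal k n ^ j) (v : Lattice n)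
    (i : ZMod n) : PowerSeries.coeff c (preRep I hI a v i) = 0 := by
  have hv : InFil I (-(n : ℤ) ^ 2) v := by
    intro i c hc
    have h1 := (abs_le.1 (abs_height_le I i)).1
    have h2 : (0 : ℤ) ≤ (n : ℤ) * c := by positivity
    omega
  refine inFil_preRep_pow I hI hk hkn ha hv i c ?_
  have h1 := (abs_le.1 (abs_height_le I i)).2
  have h2 : ((level n c : ℕ) : ℤ) ≤ j := by exact_mod_cast hj
  unfold level at h2
  push_cast at h2
  omega

/-- A representative of the `j`-th component. -/
def B.rep {k : ℕ} (b : B k n) (j : ℕ) : PreB k n := Quotient.out (B.comp j b)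

theorem B.mk_rep {k : ℕ} (b : B k n) (j : ℕ) :
    Ideal.Quotient.mk (arrowIdeal k n ^ j) (b.rep j) = B.comp j b := Quotient.out_eq _

/-- The action of an element of the completion: the coefficient of `t ^ c` is computed from a
representative modulo a high power of the arrow ideal. -/
def actFun {k : ℕ} (hI : I.card = k) (b : B k n) (v : Lattice n) : Lattice n := fun i =>
  PowerSeries.mk fun c => PowerSeries.coeff c (preRep I hI (b.rep (level n c)) v i)

theorem coeff_actFun {k : ℕ} (hI : I.card = k) (hk : 0 < k) (hkn : k < n) {b : B k n} {j : ℕ}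
    {a : PreB k n} (ha : Ideal.Quotient.mk (arrowIdeal k n ^ j) a = B.comp j b) {c : ℕ}
    (hj : level n c ≤ j) (v : Lattice n) (i : ZMod n) :
    PowerSeries.coeff c (actFun I hI b v i) = PowerSeries.coeff c (preRep I hI a v i) := by
  rw [actFun, PowerSeries.coeff_mk, ← sub_eq_zero, ← map_sub, ← Pi.sub_apply,
    ← LinearMap.sub_apply, ← map_sub]
  refine coeff_preRep_eq_zero I hI hk hkn le_rfl ?_ v i
  rw [← Ideal.Quotient.mk_eq_mk_iff_sub_mem, B.mk_rep, ← B.comp_factor b hj, ← ha,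
    Ideal.Quotient.factor_mk]

/-- The representation of `B_{k,n}` on the lattice of `I`. -/
def rep {k : ℕ} (hI : I.card = k) (hk : 0 < k) (hkn : k < n) :
    B k n →+* Module.End ℂ⟦X⟧ (Lattice n) where
  toFun b :=
    { toFun := actFun I hI b
      map_add' := fun v w => by
        funext i
        ext c
        rw [Pi.add_apply, map_add]
        simp only [actFun, PowerSeries.coeff_mk, map_add, Pi.add_apply]
      map_smul' := fun f v => by
        funext i
        ext c
        rw [coeff_actFun I hI hk hkn (B.mk_rep b _) le_rfl, map_smul, RingHom.id_apply,
          Pi.smul_apply, Pi.smul_apply, smul_eq_mul, smul_eq_mul, PowerSeries.coeff_mul,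
          PowerSeries.coeff_mul]
        refine Finset.sum_congr rfl fun p hp => ?_
        have hp' : p.1 + p.2 = c := by simpa using hp
        rw [coeff_actFun I hI hk hkn (B.mk_rep b (level n c)) (level_mono n (by omega))] }
  map_one' := by
    refine LinearMap.ext fun v => funext fun i => PowerSeries.ext fun c => ?_
    refine (coeff_actFun I hI hk hkn (a := 1) (j := level n c) (by simp) le_rfl v i).trans ?_
    rw [map_one]
  map_mul' a b := by
    refine LinearMap.ext fun v => funext fun i => PowerSeries.ext fun c => ?_
    refine (coeff_actFun I hI hk hkn (a := a.rep (level n c) * b.rep (level n c))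
      (j := level n c) (by rw [map_mul, B.mk_rep, B.mk_rep, map_mul]) le_rfl v i).trans ?_
    refine Eq.trans ?_ (coeff_actFun I hI hk hkn (a := a.rep (level n c)) (j := level n c)
      (B.mk_rep a _) le_rfl (actFun I hI b v) i).symm
    have hw : ∃ w : Lattice n, actFun I hI b v - preRep I hI (b.rep (level n c)) v =
        (PowerSeries.X ^ (c + 1) : ℂ⟦X⟧) • w := by
      have : ∀ l, ∃ g : ℂ⟦X⟧, (actFun I hI b v - preRep I hI (b.rep (level n c)) v) l =
          PowerSeries.X ^ (c + 1) * g := by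
        intro l
        refine (PowerSeries.X_pow_dvd_iff.2 fun d hd => ?_)
        rw [Pi.sub_apply, map_sub, sub_eq_zero]
        exact coeff_actFun I hI hk hkn (B.mk_rep b _) (level_mono n (by omega)) v l
      choose g hg using this
      exact ⟨g, funext hg⟩
    obtain ⟨w, hw⟩ := hw
    rw [sub_eq_iff_eq_add] at hw
    rw [hw, map_add, map_smul, map_mul, Pi.add_apply, Pi.smul_apply, map_add, smul_eq_mul,
      PowerSeries.coeff_X_pow_mul', if_neg (by omega), zero_add]
    rfl
  map_zero' := by
    refine LinearMap.ext fun v => funext fun i => PowerSeries.ext fun c => ?_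
    refine (coeff_actFun I hI hk hkn (a := 0) (j := level n c) (by simp) le_rfl v i).trans ?_
    rw [map_zero]
  map_add' a b := by
    refine LinearMap.ext fun v => funext fun i => PowerSeries.ext fun c => ?_
    refine (coeff_actFun I hI hk hkn (a := a.rep (level n c) + b.rep (level n c))
      (j := level n c) (by rw [map_add, B.mk_rep, B.mk_rep, map_add]) le_rfl v i).trans ?_
    rw [map_add]
    rw [LinearMap.add_apply, LinearMap.add_apply, Pi.add_apply, Pi.add_apply, map_add, map_add]
    simp only [LinearMap.coe_mk, AddHom.coe_mk, actFun, PowerSeries.coeff_mk]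

theorem rep_of {k : ℕ} (hI : I.card = k) (hk : 0 < k) (hkn : k < n) (a : PreB k n) :
    rep I hI hk hkn (B.of a) = preRep I hI a :=
  LinearMap.ext fun v => funext fun i => PowerSeries.ext fun _ =>
    coeff_actFun I hI hk hkn (B.comp_of _ a).symm le_rfl v i

/-- The rank one module `L_I` for a `k`-subset `I` of the edges: `Uᵢ = ℂ⟦t⟧` at every vertex, `xᵢ`
acts as multiplication by `1` if `i ∈ I` and by `t` otherwise, `yᵢ` by `t` if `i ∈ I` and by `1`
otherwise. -/
def rankOne {k : ℕ} (hI : I.card = k) (hk : 0 < k) (hkn : k < n) : ModuleCat.{0} (B k n) :=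
  letI : Module (B k n) (Lattice n) := Module.compHom (Lattice n) (rep I hI hk hkn)
  ModuleCat.of (B k n) (Lattice n)

theorem x_smul_rankOne {k : ℕ} (hI : I.card = k) (hk : 0 < k) (hkn : k < n) (i : ZMod n)
    (v : rankOne I hI hk hkn) : (B.of (PreB.x i) : B k n) • v =
      (xMap I i (v : Lattice n) : Lattice n) := by
  change rep I hI hk hkn (B.of (PreB.x i)) v = _
  rw [rep_of, preRep_x]

theorem y_smul_rankOne {k : ℕ} (hI : I.card = k) (hk : 0 < k) (hkn : k < n) (i : ZMod n)
    (v : rankOne I hI hk hkn) : (B.of (PreB.y i) : B k n) • v =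
      (yMap I i (v : Lattice n) : Lattice n) := by
  change rep I hI hk hkn (B.of (PreB.y i)) v = _
  rw [rep_of, preRep_y]

theorem e_smul_rankOne {k : ℕ} (hI : I.card = k) (hk : 0 < k) (hkn : k < n) (i : ZMod n)
    (v : rankOne I hI hk hkn) : (B.of (PreB.e i) : B k n) • v =
      (eMap i (v : Lattice n) : Lattice n) := by
  change rep I hI hk hkn (B.of (PreB.e i)) v = _
  rw [rep_of, preRep_e]

/-! ## Rims -/

/-- The peaks of the rim `I`: the vertices `i` with `i ∉ I` and `i + 1 ∈ I`. -/
def peaks : Finset (ZMod n) := {i | i ∉ I ∧ i + 1 ∈ I}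

/-- The edges `p + 1, …, p + d` form a maximal cyclic interval contained in `I`. -/
def IsMaximalInterval (p : ZMod n) (d : ℕ) : Prop :=
  0 < d ∧ p ∉ I ∧ (∀ s ∈ Finset.Icc 1 d, p + (s : ZMod n) ∈ I) ∧ p + ((d + 1 : ℕ) : ZMod n) ∉ I

/-- The lengths of the slopes of the rim `I`: the downward slopes are the maximal intervals of `I`,
the upward slopes are the maximal intervals of its complement. -/
def slopeLengths : Set ℕ :=
  {d | ∃ p, IsMaximalInterval I p d ∨ IsMaximalInterval Iᶜ p d}

/-- The minimum of the lengths of the slopes. -/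
def minSlope : ℕ := sInf (slopeLengths I)

end

/-! ## Syzygies -/

/-- `π : P ⟶ M` is a projective cover: `P` is projective, `π` is surjective, and the kernel of `π`
is superfluous. -/
def IsProjectiveCover {R : Type} [Ring R] {P M : ModuleCat.{0} R} (π : P ⟶ M) : Prop :=
  Module.Projective R P ∧ Function.Surjective π.hom ∧
    ∀ N : Submodule R P, N ⊔ LinearMap.ker π.hom = ⊤ → N = ⊤

/-- `W` is a first syzygy `Ω(M)` of `M`: it is isomorphic to the kernel of a projective cover of
`M`. As projective covers are unique up to isomorphism, so is `Ω(M)`. -/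
def IsSyzygy {R : Type} [Ring R] (M W : ModuleCat.{0} R) : Prop :=
  ∃ (P : ModuleCat.{0} R) (π : P ⟶ M), IsProjectiveCover π ∧
    Nonempty (W ≃ₗ[R] LinearMap.ker π.hom)

end CircularAlgebra
end

open CircularAlgebra

noncomputable section

namespace CircularAlgebra

/-! ## The action of the completion on the rank one modules -/

section

variable {n k : ℕ} [NeZero n] (I : Finset (ZMod n)) (hI : I.card = k) (hk : 0 < k) (hkn : k < n)

/-! Everything is made explicit through exponents of `t`. A homomorphism `L_A → L_C` commutes with
the vertex idempotents and with `t`, so it is a family of power series `g i`, one per vertex,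
compatible with the arrows (`IsFamily`). When `A` and `C` have equal size, all such families are
multiples of a single family `t ^ d i` with minimum exponent `0` (`IsFamily.eq_mul_pow`,
`exists_isDegree`). In particular `End L_A = Z`. The projective `B eₚ` is itself a rank one module,
with the interval `p + 1, …, p + k` as rim (`projective_projAt`).

Let the slopes of `I`, starting at the peak `p`, have lengths `a, b, c, d`, so that the other peak
is `q = p + a + b`. The minimal maps `B eₚ → L_I` and `B e_q → L_I` have exponents `dp` and `dq`
with disjoint supports. Hence the map from the direct sum is onto, and its kernel is `L_J`, embedded
by `(t ^ dq, -t ^ dp)`, where `J` has slopes `c, b, a, d` starting at the valley `p + a`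
(`IsTwoPeak.isResolution`). The largest values are `dp q = min b c` and `dq p = min d a`, and the
smaller of these is `m`.

Therefore `Ext¹(L_I, L_J)` is `End L_J = Z` modulo the endomorphisms that extend to the projective
cover. Such an endomorphism is a difference of two maps, one through each summand. Being constant
along the vertices, the two can be read off at `p` and at `q`, which gives divisibility by `t ^ m`
(`X_pow_dvd_familyOf_comp_ι`). Conversely `t ^ m` on `L_I` factors through `B eₚ` or `B e_q`, so it
kills `Ext¹` (`X_pow_smul_ext_eq_zero`).

For `Ext¹(L_J, L_I)` the same presentation is used for `J`, whose peaks are the valleys of `I` and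
whose minimal slope is again `m`. If `m = 1` then `t` kills this group. It is not zero, because maps
from the projectives at the valleys of `I` to `L_I` are divisible by `t` away from these valleys
(`X_dvd_of_isFamily`), so the generator of the homomorphisms from the syzygy of `L_J` to `L_I` does
not extend. -/

theorem preRep_t : preRep I hI PreB.t = (PowerSeries.X : ℂ⟦X⟧) • 1 := by
  refine LinearMap.ext fun v => ?_
  have h : ∀ i, xMap I i (yMap I i v) = Pi.single i (PowerSeries.X * v i) := by
    intro i
    rw [xMap_apply, yMap_apply, Pi.single_eq_same, ← mul_assoc, xCoeff_mul_yCoeff]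
  simp only [PreB.t, map_sum, map_mul, preRep_x, preRep_y, LinearMap.sum_apply,
    Module.End.mul_apply, h]
  exact Finset.univ_sum_single (fun i => PowerSeries.X * v i)

theorem preRep_aeval (p : Polynomial ℂ) (v : Lattice n) :
    preRep I hI (Polynomial.aeval PreB.t p) v = (p : ℂ⟦X⟧) • v := by
  induction p using Polynomial.induction_on' generalizing v with
  | add p q hp hq => rw [map_add, map_add, LinearMap.add_apply, hp, hq, Polynomial.coe_add, add_smul]
  | monomial m c =>
    rw [Polynomial.aeval_monomial, map_mul, AlgHom.commutes, map_pow, preRep_t,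
      ← Polynomial.C_mul_X_pow_eq_monomial, Polynomial.coe_mul, Polynomial.coe_pow,
      Polynomial.coe_X, Polynomial.coe_C, smul_pow, one_pow, Module.End.mul_apply, mul_smul]
    funext i
    change c • (((PowerSeries.X : ℂ⟦X⟧) ^ m • v) i) = _
    simp [PowerSeries.smul_eq_C_mul]

theorem rep_ofPowerSeries (f : ℂ⟦X⟧) (v : Lattice n) :
    rep I hI hk hkn (ofPowerSeries k n f) v = f • v := by
  funext i
  ext c
  refine (coeff_actFun I hI hk hkn (j := level n c) (comp_ofPowerSeries f _).symm le_rfl v i).trans ?_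
  rw [partialSum, preRep_aeval, Pi.smul_apply, Pi.smul_apply, smul_eq_mul, smul_eq_mul,
    PowerSeries.coeff_mul, PowerSeries.coeff_mul]
  refine Finset.sum_congr rfl fun p hp => ?_
  have hp' : p.1 + p.2 = c := by simpa using hp
  have hn := NeZero.pos n
  -- The truncation order `level n c` exceeds `c`, so no coefficient entering degree `c` is lost.
  have hl : p.1 < level n c := by
    unfold level
    nlinarith
  rw [Polynomial.coeff_coe, PowerSeries.coeff_trunc, if_pos hl]

/-- Reduces statements about the completion to the uncompleted algebra modulo `t ^ c`: one
representative serves all coefficients below `c` because `level` is monotone. -/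
theorem rep_approx (b : B k n) (c : ℕ) (v : Lattice n) : ∃ w : Lattice n,
    rep I hI hk hkn b v = preRep I hI (b.rep (level n c)) v + (PowerSeries.X ^ c : ℂ⟦X⟧) • w := by
  have : ∀ l, ∃ g : ℂ⟦X⟧, (rep I hI hk hkn b v - preRep I hI (b.rep (level n c)) v) l =
      PowerSeries.X ^ c * g := by
    intro l
    refine (PowerSeries.X_pow_dvd_iff.2 fun d hd => ?_)
    rw [Pi.sub_apply, map_sub, sub_eq_zero]
    exact coeff_actFun I hI hk hkn (B.mk_rep b _) (level_mono n hd.le) v l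
  choose g hg using this
  exact ⟨g, by rw [← sub_eq_iff_eq_add']; exact funext hg⟩

theorem Lattice.ext_of_approx {u v : Lattice n}
    (h : ∀ c : ℕ, ∃ w : Lattice n, u = v + (PowerSeries.X ^ c : ℂ⟦X⟧) • w) : u = v := by
  funext i
  ext c
  obtain ⟨w, rfl⟩ := h (c + 1)
  rw [Pi.add_apply, Pi.smul_apply, map_add, smul_eq_mul, PowerSeries.coeff_X_pow_mul',
    if_neg (by omega), add_zero]

/-- A `Z`-linear map that intertwines the actions of the uncompleted algebra intertwines the
actions of the completion. -/
theorem intertwine_rep {A C : Finset (ZMod n)} (hA : A.card = k) (hC : C.card = k)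
    (T : Lattice n →ₗ[ℂ⟦X⟧] Lattice n)
    (hT : ∀ a v, T (preRep A hA a v) = preRep C hC a (T v)) (b : B k n) (v : Lattice n) :
    T (rep A hA hk hkn b v) = rep C hC hk hkn b (T v) := by
  refine Lattice.ext_of_approx fun c => ?_
  obtain ⟨w, hw⟩ := rep_approx A hA hk hkn b c v
  obtain ⟨w', hw'⟩ := rep_approx C hC hk hkn b c (T v)
  -- By linearity over `Z`, both error terms stay multiples of `t ^ c`, and the lattice is
  -- `t`-adically separated.
  refine ⟨T w - w', ?_⟩
  rw [hw, hw', map_add, map_smul, hT, smul_sub]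
  abel

/-- The underlying lattice of a rank one module. -/
def toLattice : rankOne I hI hk hkn ≃+ Lattice n := AddEquiv.refl (Lattice n)

theorem toLattice_smul (b : B k n) (v : rankOne I hI hk hkn) :
    toLattice I hI hk hkn (b • v) = rep I hI hk hkn b (toLattice I hI hk hkn v) := rfl

theorem toLattice_algebraMap_smul (f : ℂ⟦X⟧) (v : rankOne I hI hk hkn) :
    toLattice I hI hk hkn (algebraMap ℂ⟦X⟧ (B k n) f • v) = f • toLattice I hI hk hkn v :=
  rep_ofPowerSeries I hI hk hkn f v

theorem toLattice_of_smul (a : PreB k n) (v : rankOne I hI hk hkn) :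
    toLattice I hI hk hkn (B.of a • v) = preRep I hI a (toLattice I hI hk hkn v) := by
  rw [toLattice_smul, rep_of]

end

/-! ## Homomorphisms between rank one modules -/

section

variable {n k : ℕ} [NeZero n]

/-- The families of power series that describe the homomorphisms from `L_A` to `L_C`. -/
def IsFamily (A C : Finset (ZMod n)) (g : ZMod n → ℂ⟦X⟧) : Prop :=
  ∀ i, g i * xCoeff A i = xCoeff C i * g (i - 1)

theorem xCoeff_ne_zero (A : Finset (ZMod n)) (i : ZMod n) : xCoeff A i ≠ 0 := by
  unfold xCoeff
  split_ifs
  exacts [one_ne_zero, PowerSeries.X_ne_zero]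

/-- Since `x y = t` on both sides and power series form a domain, compatibility with `x` forces
compatibility with `y`. This is why `IsFamily` mentions only the `x` coefficients. -/
theorem IsFamily.yCoeff {A C : Finset (ZMod n)} {g : ZMod n → ℂ⟦X⟧} (hg : IsFamily A C g)
    (i : ZMod n) : g (i - 1) * yCoeff A i = yCoeff C i * g i := by
  refine mul_left_cancel₀ (mul_ne_zero (xCoeff_ne_zero A i) (xCoeff_ne_zero C i)) ?_
  linear_combination (-xCoeff A i * CircularAlgebra.yCoeff A i) * hg i +
    xCoeff A i * g i * xCoeff_mul_yCoeff A i - xCoeff A i * g i * xCoeff_mul_yCoeff C i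

/-- Coordinatewise multiplication by a family of power series. -/
def diag (g : ZMod n → ℂ⟦X⟧) : Lattice n →ₗ[ℂ⟦X⟧] Lattice n where
  toFun v i := g i * v i
  map_add' v w := by funext i; simp [mul_add]
  map_smul' f v := by funext i; simp [mul_left_comm]

theorem diag_apply (g : ZMod n → ℂ⟦X⟧) (v : Lattice n) (i : ZMod n) : diag g v i = g i * v i := rfl

theorem diag_single (g : ZMod n → ℂ⟦X⟧) (i : ZMod n) (f : ℂ⟦X⟧) :
    diag g (Pi.single i f) = Pi.single i (g i * f) := by
  funext j
  rw [diag_apply]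
  by_cases h : j = i
  · subst h; simp
  · simp [Pi.single_eq_of_ne h]

theorem diag_preRep {A C : Finset (ZMod n)} (hA : A.card = k) (hC : C.card = k)
    {g : ZMod n → ℂ⟦X⟧} (hg : IsFamily A C g) (a : PreB k n) (v : Lattice n) :
    diag g (preRep A hA a v) = preRep C hC a (diag g v) := by
  induction a using PreB.induction generalizing v with
  | hc r =>
    rw [AlgHom.commutes, AlgHom.commutes]
    funext i
    change g i * (r • v i) = r • (g i * v i)
    rw [mul_smul_comm]
  | he i => rw [preRep_e, preRep_e, eMap_apply, eMap_apply, diag_single, diag_apply]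
  | hx i =>
    rw [preRep_x, preRep_x, xMap_apply, xMap_apply, diag_single, diag_apply, ← mul_assoc, hg,
      mul_assoc]
  | hy i =>
    rw [preRep_y, preRep_y, yMap_apply, yMap_apply, diag_single, diag_apply, ← mul_assoc, hg.yCoeff,
      mul_assoc]
  | hadd a b ha hb =>
    rw [map_add, map_add, LinearMap.add_apply, LinearMap.add_apply, map_add, ha, hb]
  | hmul a b ha hb => rw [map_mul, map_mul, Module.End.mul_apply, Module.End.mul_apply, ha, hb]

variable {A C D : Finset (ZMod n)} {hA : A.card = k} {hC : C.card = k} {hD : D.card = k}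
  {hk : 0 < k} {hkn : k < n}

/-- The homomorphism described by a family. -/
def homOfFamily {g : ZMod n → ℂ⟦X⟧} (hg : IsFamily A C g) :
    rankOne A hA hk hkn →ₗ[B k n] rankOne C hC hk hkn where
  toFun v := (toLattice C hC hk hkn).symm (diag g (toLattice A hA hk hkn v))
  map_add' v w := by rw [map_add, map_add, map_add]
  map_smul' b v := intertwine_rep hk hkn hA hC (diag g) (diag_preRep hA hC hg) b v

/-- A homomorphism of rank one modules as a map of lattices. -/
def latticeMap (φ : rankOne A hA hk hkn →ₗ[B k n] rankOne C hC hk hkn) :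
    Lattice n →ₗ[ℂ⟦X⟧] Lattice n where
  toFun v := toLattice C hC hk hkn (φ ((toLattice A hA hk hkn).symm v))
  map_add' v w := by rw [map_add, map_add, map_add]
  map_smul' f v := by
    rw [RingHom.id_apply, ← toLattice_algebraMap_smul, ← map_smul]
    congr 2
    rw [AddEquiv.symm_apply_eq, toLattice_algebraMap_smul, AddEquiv.apply_symm_apply]

theorem latticeMap_preRep (φ : rankOne A hA hk hkn →ₗ[B k n] rankOne C hC hk hkn) (a : PreB k n)
    (v : Lattice n) : latticeMap φ (preRep A hA a v) = preRep C hC a (latticeMap φ v) := by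
  have h := congrArg (toLattice C hC hk hkn)
    (φ.map_smul (B.of a) ((toLattice A hA hk hkn).symm v))
  rw [toLattice_of_smul] at h
  refine Eq.trans (congrArg (fun w => toLattice C hC hk hkn (φ w)) ?_) h
  rw [AddEquiv.symm_apply_eq, toLattice_of_smul, AddEquiv.apply_symm_apply]

/-- The family of a homomorphism. -/
def familyOf (φ : rankOne A hA hk hkn →ₗ[B k n] rankOne C hC hk hkn) (i : ZMod n) : ℂ⟦X⟧ :=
  latticeMap φ (Pi.single i 1) i

/-- Commuting with the idempotent at `i` makes the map diagonal, and linearity over `Z` makes each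
diagonal entry a multiplication. -/
theorem latticeMap_single (φ : rankOne A hA hk hkn →ₗ[B k n] rankOne C hC hk hkn) (i : ZMod n)
    (f : ℂ⟦X⟧) : latticeMap φ (Pi.single i f) = Pi.single i (familyOf φ i * f) := by
  have h := latticeMap_preRep φ (PreB.e i) (Pi.single i f)
  rw [preRep_e, preRep_e, eMap_apply, eMap_apply, Pi.single_eq_same] at h
  rw [h]
  congr 1
  have h2 : (Pi.single i f : Lattice n) = f • (Pi.single i 1 : Lattice n) := by
    rw [← Pi.single_smul, smul_eq_mul, mul_one]
  rw [h2, map_smul, Pi.smul_apply, smul_eq_mul, mul_comm]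
  rfl

theorem latticeMap_eq_diag (φ : rankOne A hA hk hkn →ₗ[B k n] rankOne C hC hk hkn)
    (v : Lattice n) : latticeMap φ v = diag (familyOf φ) v := by
  conv_lhs => rw [← Finset.univ_sum_single v]
  rw [map_sum]
  simp only [latticeMap_single]
  exact Finset.univ_sum_single (fun i => familyOf φ i * v i)

theorem toLattice_hom_apply (φ : rankOne A hA hk hkn →ₗ[B k n] rankOne C hC hk hkn)
    (v : rankOne A hA hk hkn) :
    toLattice C hC hk hkn (φ v) = diag (familyOf φ) (toLattice A hA hk hkn v) :=
  latticeMap_eq_diag φ (toLattice A hA hk hkn v)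

theorem isFamily_familyOf (φ : rankOne A hA hk hkn →ₗ[B k n] rankOne C hC hk hkn) :
    IsFamily A C (familyOf φ) := by
  intro i
  have h := latticeMap_preRep φ (PreB.x i) (Pi.single (i - 1) 1)
  rw [preRep_x, preRep_x, xMap_apply, xMap_apply, Pi.single_eq_same, latticeMap_single,
    latticeMap_single, Pi.single_eq_same] at h
  simpa using congrFun h i

theorem familyOf_homOfFamily {g : ZMod n → ℂ⟦X⟧} (hg : IsFamily A C g) :
    familyOf (homOfFamily hg : rankOne A hA hk hkn →ₗ[B k n] rankOne C hC hk hkn) = g := by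
  funext i
  change diag g (Pi.single i 1) i = g i
  rw [diag_single, Pi.single_eq_same, mul_one]

theorem hom_ext {φ ψ : rankOne A hA hk hkn →ₗ[B k n] rankOne C hC hk hkn}
    (h : familyOf φ = familyOf ψ) : φ = ψ :=
  LinearMap.ext fun v => (toLattice C hC hk hkn).injective <| by
    rw [toLattice_hom_apply, toLattice_hom_apply, h]

theorem familyOf_comp (ψ : rankOne C hC hk hkn →ₗ[B k n] rankOne D hD hk hkn)
    (φ : rankOne A hA hk hkn →ₗ[B k n] rankOne C hC hk hkn) (i : ZMod n) :
    familyOf (ψ ∘ₗ φ) i = familyOf ψ i * familyOf φ i := by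
  change latticeMap ψ (latticeMap φ (Pi.single i 1)) i = _
  rw [latticeMap_single, latticeMap_single, Pi.single_eq_same, mul_one]

/-! ### Degree functions -/

/-- The families of powers of `t`, by their exponents. -/
def IsDegree (A C : Finset (ZMod n)) (d : ZMod n → ℕ) : Prop :=
  ∀ i, d i + (if i ∈ A then 0 else 1) = d (i - 1) + (if i ∈ C then 0 else 1)

theorem xCoeff_eq_pow (A : Finset (ZMod n)) (i : ZMod n) :
    xCoeff A i = PowerSeries.X ^ (if i ∈ A then 0 else 1) := by
  unfold xCoeff
  split_ifs <;> simp

theorem IsDegree.isFamily {d : ZMod n → ℕ} (hd : IsDegree A C d) :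
    IsFamily A C (fun i => PowerSeries.X ^ d i) := by
  intro i
  rw [xCoeff_eq_pow, xCoeff_eq_pow, ← pow_add, ← pow_add, hd i, add_comm]

theorem ZMod.induction_succ {P : ZMod n → Prop} (i₀ : ZMod n) (h0 : P i₀)
    (h : ∀ i, P (i - 1) → P i) (i : ZMod n) : P i := by
  have : ∀ s : ℕ, P (i₀ + s) := by
    intro s
    induction s with
    | zero => simpa using h0
    | succ s ih =>
      refine h _ ?_
      rwa [Nat.cast_succ, ← add_assoc, add_sub_cancel_right]
  have h2 := this (i - i₀).val
  rwa [ZMod.natCast_zmod_val, add_sub_cancel] at h2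

/-- The ratio `g i / t ^ d i` does not change along an arrow, hence is the same at all vertices. The
statement is this with denominators cleared. -/
theorem IsFamily.mul_pow_eq {g : ZMod n → ℂ⟦X⟧} (hg : IsFamily A C g) {d : ZMod n → ℕ}
    (hd : IsDegree A C d) (i j : ZMod n) :
    g j * PowerSeries.X ^ d i = g i * PowerSeries.X ^ d j := by
  induction j using ZMod.induction_succ i with
  | h0 => rfl
  | h j ih =>
    refine mul_right_cancel₀ (xCoeff_ne_zero A j) ?_
    have h2 := hd.isFamily j
    simp only at h2
    linear_combination PowerSeries.X ^ d i * hg j + xCoeff C j * ih - g i * h2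

theorem IsFamily.eq_mul_pow {g : ZMod n → ℂ⟦X⟧} (hg : IsFamily A C g) {d : ZMod n → ℕ}
    (hd : IsDegree A C d) {i : ZMod n} (hi : d i = 0) (j : ZMod n) :
    g j = g i * PowerSeries.X ^ d j := by
  simpa [hi] using hg.mul_pow_eq hd i j

/-- Two rims of the same size are related by a degree function that vanishes somewhere. -/
theorem exists_isDegree (h : A.card = C.card) : ∃ d : ZMod n → ℕ, IsDegree A C d ∧ ∃ i, d i = 0 := by
  have hn : (n : ℤ) ≠ 0 := by exact_mod_cast NeZero.ne n
  let cnt : Finset (ZMod n) → ZMod n → ℤ := fun S i =>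
    ∑ s ∈ Finset.range i.val, if ((s + 1 : ℕ) : ZMod n) ∈ S then 1 else 0
  have hcnt : ∀ S i, height S i = n * cnt S i - i.val * S.card := by
    intro S i
    simp only [height, slopeStep, cnt, Finset.sum_sub_distrib, Finset.mul_sum]
    simp
  -- The degree at `i` is the surplus of edges of `A` over edges of `C` between `0` and `i`. Equal
  -- cardinalities make it well defined around the cycle, and subtracting the minimum makes it
  -- nonnegative with a zero.
  let D : ZMod n → ℤ := fun i => cnt A i - cnt C i
  have hD : ∀ i, D i + (if i ∈ A then 0 else 1) = D (i - 1) + (if i ∈ C then 0 else 1) := by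
    intro i
    have h1 := height_eq A i
    have h2 := height_eq C i
    rw [hcnt, hcnt A] at h1
    rw [hcnt, hcnt C, ← h] at h2
    have h3 : (n : ℤ) * (D i - D (i - 1)) =
        (if i ∈ A then (n : ℤ) else 0) - (if i ∈ C then (n : ℤ) else 0) := by
      simp only [D, slopeStep, ← h] at *
      linarith
    have h4 : D i - D (i - 1) = (if i ∈ A then (1 : ℤ) else 0) - (if i ∈ C then (1 : ℤ) else 0) := by
      refine mul_left_cancel₀ hn ?_
      rw [h3, mul_sub]
      simp
    split_ifs at h4 ⊢ <;> linarith
  obtain ⟨i₀, hi₀⟩ := Finite.exists_min D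
  refine ⟨fun i => (D i - D i₀).toNat, fun i => ?_, i₀, by simp⟩
  have h1 := hD i
  have h2 := hi₀ i
  have h3 := hi₀ (i - 1)
  simp only
  split_ifs at h1 ⊢ <;> omega

end

/-! ## The indecomposable projective modules -/

section

variable {n : ℕ} [NeZero n]

/-- Representatives run over `1, …, n` rather than `0, …, n - 1`, because the first edge after the
vertex `p` is `p + 1` and the last one is `p` itself. -/
theorem exists_add_natCast (p i : ZMod n) : ∃ s : ℕ, 1 ≤ s ∧ s ≤ n ∧ i = p + s := by
  refine ⟨(i - p - 1).val + 1, by omega, ZMod.val_lt _, ?_⟩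
  rw [Nat.cast_succ, ZMod.natCast_zmod_val]
  ring

theorem add_natCast_injOn (p : ZMod n) {s u : ℕ} (hs : 1 ≤ s) (hs' : s ≤ n) (hu : 1 ≤ u)
    (hu' : u ≤ n) (h : p + (s : ZMod n) = p + u) : s = u := by
  have h1 : ((s - 1 : ℕ) : ZMod n) = ((u - 1 : ℕ) : ZMod n) := by
    rw [Nat.cast_sub hs, Nat.cast_sub hu, add_left_cancel h]
  have h2 := congrArg ZMod.val h1
  rw [ZMod.val_cast_of_lt (by omega), ZMod.val_cast_of_lt (by omega)] at h2
  omega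

/-- The edges `p + 1, …, p + k`. -/
def interval (p : ZMod n) (k : ℕ) : Finset (ZMod n) := (Finset.Icc 1 k).image fun s : ℕ => p + s

theorem card_interval (p : ZMod n) {k : ℕ} (hk : k ≤ n) : (interval p k).card = k := by
  rw [interval, Finset.card_image_of_injOn, Nat.card_Icc, Nat.add_sub_cancel]
  intro s hs u hu h
  simp only [Finset.coe_Icc, Set.mem_Icc] at hs hu
  exact add_natCast_injOn p hs.1 (hs.2.trans hk) hu.1 (hu.2.trans hk) h

theorem add_mem_interval (p : ZMod n) {k s : ℕ} (hk : k ≤ n) (hs : 1 ≤ s) (hs' : s ≤ n) :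
    p + (s : ZMod n) ∈ interval p k ↔ s ≤ k := by
  rw [interval, Finset.mem_image]
  constructor
  · rintro ⟨u, hu, h⟩
    rw [Finset.mem_Icc] at hu
    rw [← add_natCast_injOn p hu.1 (hu.2.trans hk) hs hs' h]
    exact hu.2
  · intro h
    exact ⟨s, Finset.mem_Icc.2 ⟨hs, h⟩, rfl⟩

end

/-! ### Shortest paths and the projectivity of `B eₚ` -/

section

variable {k n : ℕ} [NeZero n]

/-- The sum of the arrows `xᵢ`. -/
def PreB.sumX : PreB k n := ∑ i, PreB.x i

/-- The sum of the arrows `yᵢ`. -/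
def PreB.sumY : PreB k n := ∑ i, PreB.y i

theorem PreB.sum_e : (∑ i, PreB.e i : PreB k n) = 1 := by
  simpa [PreB.e] using PreB.mk_rel (k := k) (Rel.sum_e (n := n))

theorem PreB.e_mul_sumX (i : ZMod n) : (PreB.e i * PreB.sumX : PreB k n) = PreB.x i := by
  rw [PreB.sumX, Finset.mul_sum, Finset.sum_eq_single i]
  · exact PreB.e_mul_x i
  · intro j _ hj
    rw [← PreB.e_mul_x j, ← mul_assoc, PreB.e_mul_e_ne _ _ hj.symm, zero_mul]
  · simp

theorem PreB.sumX_mul_e (i : ZMod n) : (PreB.sumX * PreB.e i : PreB k n) = PreB.x (i + 1) := by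
  rw [PreB.sumX, Finset.sum_mul, Finset.sum_eq_single (i + 1)]
  · have := PreB.x_mul_e (k := k) (i + 1)
    rwa [add_sub_cancel_right] at this
  · intro j _ hj
    rw [← PreB.x_mul_e j, mul_assoc, PreB.e_mul_e_ne, mul_zero]
    rintro rfl
    simp at hj
  · simp

theorem PreB.e_mul_sumY (i : ZMod n) : (PreB.e i * PreB.sumY : PreB k n) = PreB.y (i + 1) := by
  rw [PreB.sumY, Finset.mul_sum, Finset.sum_eq_single (i + 1)]
  · have := PreB.e_mul_y (k := k) (i + 1)
    rwa [add_sub_cancel_right] at this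
  · intro j _ hj
    rw [← PreB.e_mul_y j, ← mul_assoc, PreB.e_mul_e_ne, zero_mul]
    rintro rfl
    simp at hj
  · simp

theorem PreB.sumY_mul_e (i : ZMod n) : (PreB.sumY * PreB.e i : PreB k n) = PreB.y i := by
  rw [PreB.sumY, Finset.sum_mul, Finset.sum_eq_single i]
  · exact PreB.y_mul_e i
  · intro j _ hj
    rw [← PreB.y_mul_e j, mul_assoc, PreB.e_mul_e_ne _ _ hj, mul_zero]
  · simp

theorem PreB.eq_of_e_mul {a b : PreB k n} (h : ∀ i, PreB.e i * a = PreB.e i * b) : a = b := by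
  rw [← one_mul a, ← one_mul b, ← PreB.sum_e, Finset.sum_mul, Finset.sum_mul]
  exact Finset.sum_congr rfl fun i _ => h i

theorem PreB.sumX_mul_sumY : (PreB.sumX * PreB.sumY : PreB k n) = PreB.t := by
  refine PreB.eq_of_e_mul fun i => ?_
  rw [← mul_assoc, PreB.e_mul_sumX, PreB.e_mul_t, ← PreB.x_mul_e, mul_assoc, mul_assoc,
    PreB.e_mul_sumY, sub_add_cancel, PreB.e_mul_y]

theorem PreB.sumY_mul_sumX : (PreB.sumY * PreB.sumX : PreB k n) = PreB.t := by
  refine PreB.eq_of_e_mul fun i => ?_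
  rw [← mul_assoc, PreB.e_mul_sumY, PreB.e_mul_t, PreB.x_mul_y, ← PreB.y_mul_e, mul_assoc,
    mul_assoc, PreB.e_mul_sumX, PreB.e_mul_x]

theorem PreB.e_mul_sumX_pow (p : ZMod n) (s : ℕ) :
    (PreB.e (p + (s : ZMod n)) * PreB.sumX ^ s : PreB k n) = PreB.sumX ^ s * PreB.e p := by
  induction s with
  | zero => simp
  | succ s ih =>
    have h : (PreB.e (p + ((s + 1 : ℕ) : ZMod n)) * PreB.sumX : PreB k n) =
        PreB.sumX * PreB.e (p + (s : ZMod n)) := by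
      rw [PreB.e_mul_sumX, PreB.sumX_mul_e, Nat.cast_succ, add_assoc]
    rw [pow_succ', ← mul_assoc, h, mul_assoc, ih, mul_assoc]

theorem PreB.e_mul_sumY_pow (p : ZMod n) (s : ℕ) :
    (PreB.e (p - (s : ZMod n)) * PreB.sumY ^ s : PreB k n) = PreB.sumY ^ s * PreB.e p := by
  induction s with
  | zero => simp
  | succ s ih =>
    have h : (PreB.e (p - ((s + 1 : ℕ) : ZMod n)) * PreB.sumY : PreB k n) =
        PreB.sumY * PreB.e (p - (s : ZMod n)) := by
      rw [PreB.e_mul_sumY, PreB.sumY_mul_e, Nat.cast_succ]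
      congr 1
      ring
    rw [pow_succ', ← mul_assoc, h, mul_assoc, ih, mul_assoc]

theorem PreB.sumX_pow_mul_e (p : ZMod n) :
    (PreB.sumX ^ k * PreB.e p : PreB k n) = PreB.sumY ^ (n - k) * PreB.e p := by
  simpa [PreB.e, PreB.sumX, PreB.sumY, PreB.x, PreB.y] using PreB.mk_rel (Rel.pow (k := k) p)

/-- A shortest path from `p` to `l`. -/
def PreB.path (p l : ZMod n) : PreB k n :=
  (if (l - p).val ≤ k then PreB.sumX ^ (l - p).val else PreB.sumY ^ (n - (l - p).val)) * PreB.e p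

theorem PreB.path_add (hkn : k < n) (p : ZMod n) {s : ℕ} (hs : s ≤ n) :
    (PreB.path p (p + (s : ZMod n)) : PreB k n) =
      (if s ≤ k then PreB.sumX ^ s else PreB.sumY ^ (n - s)) * PreB.e p := by
  rw [PreB.path, add_sub_cancel_left]
  rcases hs.lt_or_eq with h | rfl
  · rw [ZMod.val_cast_of_lt h]
  -- A full turn gives `val = 0`: the empty path, which is also `n - n` steps along `y`.
  · simp [hkn.not_ge]

/-- The formula in `y` remains valid at `s = k`; this is the relation `x ^ k = y ^ (n - k)`. -/
theorem PreB.path_add' (hkn : k < n) (p : ZMod n) {s : ℕ} (hs : s ≤ n) (hks : k ≤ s) :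
    (PreB.path p (p + (s : ZMod n)) : PreB k n) = PreB.sumY ^ (n - s) * PreB.e p := by
  rw [PreB.path_add hkn p hs]
  rcases hks.lt_or_eq with h | rfl
  · rw [if_neg h.not_ge]
  · rw [if_pos le_rfl, PreB.sumX_pow_mul_e]

theorem PreB.path_self (p : ZMod n) : (PreB.path p p : PreB k n) = PreB.e p := by
  simp [PreB.path]

theorem PreB.e_mul_path (hkn : k < n) (p l : ZMod n) :
    (PreB.e l * PreB.path p l : PreB k n) = PreB.path p l := by
  obtain ⟨s, hs, hs', rfl⟩ := exists_add_natCast p l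
  rw [PreB.path_add hkn p hs']
  split_ifs with h
  · rw [← mul_assoc, PreB.e_mul_sumX_pow, mul_assoc, PreB.e_mul_e]
  · have h2 : p + (s : ZMod n) = p - ((n - s : ℕ) : ZMod n) := by
      rw [Nat.cast_sub hs', ZMod.natCast_self]
      ring
    rw [h2, ← mul_assoc, PreB.e_mul_sumY_pow, mul_assoc, PreB.e_mul_e]

/-- Up to length `k` the shortest path consists of `x`'s and one more prolongs it; beyond that it
consists of `y`'s, and `x` cancels one of them into `t`. The coefficients are those of the rank one
module of the interval. -/
theorem PreB.sumX_mul_path (hkn : k < n) (p l : ZMod n) :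
    (PreB.sumX * PreB.path p (l - 1) : PreB k n) =
      (if l ∈ interval p k then 1 else PreB.t) * PreB.path p l := by
  obtain ⟨s, hs, hs', rfl⟩ := exists_add_natCast p l
  obtain ⟨s, rfl⟩ := Nat.exists_eq_add_of_le' hs
  have h1 : p + ((s + 1 : ℕ) : ZMod n) - 1 = p + (s : ZMod n) := by push_cast; ring
  rw [h1]
  simp only [add_mem_interval p hkn.le hs hs']
  split_ifs with h
  · rw [PreB.path_add hkn p hs', PreB.path_add hkn p (by omega), if_pos h, if_pos (by omega),
      one_mul, ← mul_assoc, pow_succ']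
  · rw [PreB.path_add' hkn p hs' (by omega), PreB.path_add' hkn p (by omega) (by omega),
      show n - s = (n - (s + 1)) + 1 by omega, pow_succ', mul_assoc, ← mul_assoc PreB.sumX,
      PreB.sumX_mul_sumY]

theorem PreB.sumY_mul_path (hkn : k < n) (p l : ZMod n) :
    (PreB.sumY * PreB.path p l : PreB k n) =
      (if l ∈ interval p k then PreB.t else 1) * PreB.path p (l - 1) := by
  obtain ⟨s, hs, hs', rfl⟩ := exists_add_natCast p l
  obtain ⟨s, rfl⟩ := Nat.exists_eq_add_of_le' hs
  have h1 : p + ((s + 1 : ℕ) : ZMod n) - 1 = p + (s : ZMod n) := by push_cast; ring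
  rw [h1]
  simp only [add_mem_interval p hkn.le hs hs']
  split_ifs with h
  · rw [PreB.path_add hkn p hs', PreB.path_add hkn p (by omega), if_pos h, if_pos (by omega),
      pow_succ', mul_assoc, ← mul_assoc PreB.sumY, PreB.sumY_mul_sumX]
  · rw [PreB.path_add' hkn p hs' (by omega), PreB.path_add' hkn p (by omega) (by omega),
      show n - s = (n - (s + 1)) + 1 by omega, pow_succ', one_mul, mul_assoc]

theorem PreB.x_mul_path (hkn : k < n) (p l : ZMod n) :
    (PreB.x l * PreB.path p (l - 1) : PreB k n) =
      (if l ∈ interval p k then 1 else PreB.t) * PreB.path p l := by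
  rw [← PreB.e_mul_sumX, mul_assoc, PreB.sumX_mul_path hkn]
  split_ifs
  · rw [one_mul, PreB.e_mul_path hkn]
  · rw [← mul_assoc, ← PreB.t_comm, mul_assoc, PreB.e_mul_path hkn]

theorem PreB.y_mul_path (hkn : k < n) (p l : ZMod n) :
    (PreB.y l * PreB.path p l : PreB k n) =
      (if l ∈ interval p k then PreB.t else 1) * PreB.path p (l - 1) := by
  have h : (PreB.y l : PreB k n) = PreB.e (l - 1) * PreB.sumY := by
    rw [PreB.e_mul_sumY, sub_add_cancel]
  rw [h, mul_assoc, PreB.sumY_mul_path hkn]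
  split_ifs
  · rw [← mul_assoc, ← PreB.t_comm, mul_assoc, PreB.e_mul_path hkn]
  · rw [one_mul, PreB.e_mul_path hkn]

theorem ofPowerSeries_C (r : ℂ) :
    ofPowerSeries k n (PowerSeries.C r) = B.of (algebraMap ℂ (PreB k n) r) := by
  ext j
  rw [comp_ofPowerSeries, B.comp_of, partialSum, ← Polynomial.aeval_C (R := ℂ) PreB.t]
  refine mk_aeval_eq fun c hc => ?_
  simp [PowerSeries.coeff_trunc, hc, Polynomial.coeff_C, PowerSeries.coeff_C]

/-- The map from the lattice to `B` that sends the basis vector at `l` to the shortest path from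
`p` to `l`. -/
def latticeToB (p : ZMod n) : Lattice n →+ B k n where
  toFun v := ∑ l, ofPowerSeries k n (v l) * B.of (PreB.path p l)
  map_zero' := by simp
  map_add' v w := by simp [add_mul, Finset.sum_add_distrib]

theorem latticeToB_single (p l : ZMod n) (f : ℂ⟦X⟧) :
    latticeToB p (Pi.single l f) = ofPowerSeries k n f * B.of (PreB.path p l) := by
  change ∑ j, _ = _
  rw [Finset.sum_eq_single l]
  · rw [Pi.single_eq_same]
  · intro j _ hj
    rw [Pi.single_eq_of_ne hj, map_zero, zero_mul]
  · simp

theorem latticeToB_smul (p : ZMod n) (f : ℂ⟦X⟧) (v : Lattice n) :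
    latticeToB p (f • v) = ofPowerSeries k n f * latticeToB p v := by
  change ∑ j, _ = _ * ∑ j, _
  rw [Finset.mul_sum]
  refine Finset.sum_congr rfl fun j _ => ?_
  rw [Pi.smul_apply, smul_eq_mul, map_mul, mul_assoc]

theorem latticeToB_preRep (hkn : k < n) (p : ZMod n) (a : PreB k n) (v : Lattice n) :
    latticeToB p (preRep (interval p k) (card_interval p hkn.le) a v) =
      B.of a * latticeToB p v := by
  have hsum : ∀ (T : Module.End ℂ⟦X⟧ (Lattice n)) (b : B k n),
      (∀ l f, latticeToB p (T (Pi.single l f)) = b * latticeToB p (Pi.single l f)) →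
      ∀ v, latticeToB p (T v) = b * latticeToB p v := by
    intro T b h v
    rw [← Finset.univ_sum_single v, map_sum, map_sum, map_sum, Finset.mul_sum]
    exact Finset.sum_congr rfl fun l _ => h l _
  induction a using PreB.induction generalizing v with
  | hc r =>
    rw [AlgHom.commutes, ← ofPowerSeries_C, ← latticeToB_smul]
    congr 1
    funext i
    change r • v i = _
    simp [PowerSeries.smul_eq_C_mul]
  | he i =>
    rw [preRep_e]
    refine hsum _ _ (fun l f => ?_) v
    rw [eMap_apply, latticeToB_single, latticeToB_single, ← mul_assoc, ← ofPowerSeries_comm,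
      mul_assoc, ← map_mul]
    by_cases h : i = l
    · subst h
      rw [Pi.single_eq_same, PreB.e_mul_path hkn]
    · rw [Pi.single_eq_of_ne h, map_zero, zero_mul, ← PreB.e_mul_path hkn p l, ← mul_assoc,
        PreB.e_mul_e_ne _ _ h, zero_mul, map_zero, mul_zero]
  | hx i =>
    rw [preRep_x]
    refine hsum _ _ (fun l f => ?_) v
    rw [xMap_apply, latticeToB_single, latticeToB_single, ← mul_assoc, ← ofPowerSeries_comm,
      mul_assoc, ← map_mul]
    by_cases h : i - 1 = l
    · subst h
      rw [Pi.single_eq_same, PreB.x_mul_path hkn, mul_comm, map_mul, mul_assoc, xCoeff]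
      split_ifs
      · rw [map_one, one_mul, one_mul]
      · rw [map_mul, ofPowerSeries_X]
    · rw [Pi.single_eq_of_ne h, mul_zero, map_zero, zero_mul, ← PreB.e_mul_path hkn p l,
        ← PreB.x_mul_e, mul_assoc, ← mul_assoc (PreB.e (i - 1)),
        PreB.e_mul_e_ne _ _ h, zero_mul, mul_zero, map_zero, mul_zero]
  | hy i =>
    rw [preRep_y]
    refine hsum _ _ (fun l f => ?_) v
    rw [yMap_apply, latticeToB_single, latticeToB_single, ← mul_assoc, ← ofPowerSeries_comm,
      mul_assoc, ← map_mul]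
    by_cases h : i = l
    · subst h
      rw [Pi.single_eq_same, PreB.y_mul_path hkn, mul_comm, map_mul, mul_assoc, yCoeff]
      split_ifs
      · rw [map_mul, ofPowerSeries_X]
      · rw [map_one, one_mul, one_mul]
    · rw [Pi.single_eq_of_ne h, mul_zero, map_zero, zero_mul, ← PreB.e_mul_path hkn p l,
        ← PreB.y_mul_e, mul_assoc, ← mul_assoc (PreB.e i),
        PreB.e_mul_e_ne _ _ h, zero_mul, mul_zero, map_zero, mul_zero]
  | hadd a b ha hb => rw [map_add, LinearMap.add_apply, map_add, ha, hb, map_add, add_mul]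
  | hmul a b ha hb => rw [map_mul, Module.End.mul_apply, ha, hb, map_mul, mul_assoc]

/-- In the `j`-th component of the completion `b` may be replaced by a representative and the error
term, a multiple of `t ^ j`, vanishes. The claim then follows from the uncompleted case. -/
theorem latticeToB_rep (hk : 0 < k) (hkn : k < n) (p : ZMod n) (b : B k n) (v : Lattice n) :
    latticeToB p (rep (interval p k) (card_interval p hkn.le) hk hkn b v) =
      b * latticeToB p v := by
  ext j
  obtain ⟨w, hw⟩ := rep_approx (interval p k) (card_interval p hkn.le) hk hkn b j v
  have hj : j ≤ level n j := by
    have := NeZero.pos n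
    unfold level
    nlinarith
  have hb : B.comp j b = B.comp j (B.of (b.rep (level n j))) := by
    rw [B.comp_of, ← B.comp_factor b hj, ← B.mk_rep, Ideal.Quotient.factor_mk]
  have ht : B.comp j (ofPowerSeries k n (PowerSeries.X ^ j)) = 0 := by
    rw [map_pow, ofPowerSeries_X, ← map_pow, B.comp_of, Ideal.Quotient.eq_zero_iff_mem]
    exact t_pow_mem le_rfl
  rw [hw, map_add, latticeToB_preRep hkn, latticeToB_smul, map_add, map_mul, map_mul, ht, zero_mul,
    add_zero, map_mul, hb]

/-- The indecomposable projective module `B eₚ`, as a rank one module. -/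
abbrev projAt (hk : 0 < k) (hkn : k < n) (p : ZMod n) : ModuleCat.{0} (B k n) :=
  rankOne (interval p k) (card_interval p hkn.le) hk hkn

/-- The module is a retract of `B`: `Φ` sends basis vectors to shortest paths, and `Ψ` evaluates at
the basis vector of `p`. The composite `Ψ Φ` is an endomorphism of a rank one module, hence
determined at the single vertex `p`, where it is `1`. No description of `B` as a `Z`-module is
needed. -/
instance projective_projAt (hk : 0 < k) (hkn : k < n) (p : ZMod n) :
    Module.Projective (B k n) (projAt hk hkn p) := by
  let T := toLattice (interval p k) (card_interval p hkn.le) hk hkn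
  let Φ : projAt hk hkn p →ₗ[B k n] B k n :=
    { toFun := fun v => latticeToB p (T v)
      map_add' := fun v w => by rw [map_add, map_add]
      map_smul' := fun b v => latticeToB_rep hk hkn p b (T v) }
  let Ψ : B k n →ₗ[B k n] projAt hk hkn p :=
    LinearMap.toSpanSingleton (B k n) _ (T.symm (Pi.single p 1))
  refine Module.Projective.of_split Φ Ψ ?_
  let χ : rankOne (interval p k) (card_interval p hkn.le) hk hkn →ₗ[B k n]
    rankOne (interval p k) (card_interval p hkn.le) hk hkn := Ψ ∘ₗ Φ
  have h1 : T (χ (T.symm (Pi.single p 1))) = Pi.single p 1 := by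
    change T ((latticeToB p (T (T.symm (Pi.single p 1))) : B k n) • T.symm (Pi.single p 1)) = _
    rw [AddEquiv.apply_symm_apply, latticeToB_single, map_one, one_mul, PreB.path_self,
      toLattice_of_smul, preRep_e, eMap_apply]
    rw [show toLattice (interval p k) (card_interval p hkn.le) hk hkn (T.symm (Pi.single p 1)) =
      Pi.single p 1 from T.apply_symm_apply _, Pi.single_eq_same]
  have h2 : familyOf χ p = 1 := by
    have := congrFun h1 p
    rwa [Pi.single_eq_same] at this
  have h3 : χ = LinearMap.id := by
    refine hom_ext (funext fun j => ?_)
    have hd : IsDegree (interval p k) (interval p k) (fun _ => 0) := fun i => rfl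
    rw [(isFamily_familyOf χ).eq_mul_pow hd (i := p) rfl j,
      (isFamily_familyOf LinearMap.id).eq_mul_pow hd (i := p) rfl j, h2]
    congr 1
    exact (Pi.single_eq_same (M := fun _ : ZMod n => ℂ⟦X⟧) p 1).symm
  exact h3

end

/-! ## Rims with two peaks -/

section

variable {n : ℕ} [NeZero n]

/-- The rim `I` has a peak at `p`, and its slopes, clockwise from `p`, have lengths
`a`, `b`, `c`, `d`. -/
structure IsTwoPeak (I : Finset (ZMod n)) (p : ZMod n) (a b c d : ℕ) : Prop where
  ha : 0 < a
  hb : 0 < b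
  hc : 0 < c
  hd : 0 < d
  sum : a + b + c + d = n
  mem : ∀ s : ℕ, 1 ≤ s → s ≤ n → (p + (s : ZMod n) ∈ I ↔ s ≤ a ∨ (a + b < s ∧ s ≤ a + b + c))

theorem add_add_natCast (p : ZMod n) (r s : ℕ) :
    p + (r : ZMod n) + (s : ZMod n) = p + ((r + s : ℕ) : ZMod n) := by
  push_cast
  ring

theorem add_natCast_sub_card (p : ZMod n) {s : ℕ} (h : n ≤ s) :
    p + (s : ZMod n) = p + ((s - n : ℕ) : ZMod n) := by
  rw [Nat.cast_sub h, ZMod.natCast_self, sub_zero]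

theorem add_natCast_add_card (p : ZMod n) (s : ℕ) :
    p + ((s + n : ℕ) : ZMod n) = p + (s : ZMod n) := by
  rw [Nat.cast_add, ZMod.natCast_self, add_zero]

theorem add_succ_sub_one (p : ZMod n) {s : ℕ} (hs : 1 ≤ s) :
    p + (s : ZMod n) - 1 = p + ((s - 1 : ℕ) : ZMod n) := by
  rw [Nat.cast_sub hs]
  push_cast
  ring

/-- The position relative to the base point `p + r`. -/
theorem add_natCast_eq_rotate (p : ZMod n) {r s : ℕ} (hr : r ≤ n) :
    p + (s : ZMod n) =
      p + (r : ZMod n) + ((if r < s then s - r else s + n - r : ℕ) : ZMod n) := by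
  rw [add_add_natCast]
  split_ifs with h
  · rw [Nat.add_sub_cancel' h.le]
  · rw [Nat.add_sub_cancel' (by omega), add_natCast_add_card]

namespace IsTwoPeak

variable {I : Finset (ZMod n)} {p : ZMod n} {a b c d : ℕ}

/-- Together with `compl`, this symmetry lets facts about all four slopes be deduced from the first
one. -/
theorem rotate (h : IsTwoPeak I p a b c d) :
    IsTwoPeak I (p + ((a + b : ℕ) : ZMod n)) c d a b where
  ha := h.hc
  hb := h.hd
  hc := h.ha
  hd := h.hb
  sum := by have := h.sum; omega
  mem s hs hs' := by
    have h1 := h.sum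
    rw [add_add_natCast]
    by_cases hn : a + b + s ≤ n
    · rw [h.mem _ (by omega) hn]
      omega
    · rw [add_natCast_sub_card p (by omega), h.mem _ (by omega) (by omega)]
      omega

theorem compl (h : IsTwoPeak I p a b c d) : IsTwoPeak Iᶜ (p + (a : ZMod n)) b c d a where
  ha := h.hb
  hb := h.hc
  hc := h.hd
  hd := h.ha
  sum := by have := h.sum; omega
  mem s hs hs' := by
    have h1 := h.sum
    rw [add_add_natCast, Finset.mem_compl]
    by_cases hn : a + s ≤ n
    · rw [h.mem _ (by omega) hn]
      omega
    · rw [add_natCast_sub_card p (by omega), h.mem _ (by omega) (by omega)]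
      omega

theorem self_notMem (h : IsTwoPeak I p a b c d) : p ∉ I := by
  have h1 := h.sum
  have h2 := h.hd
  have := h.mem n (by omega) le_rfl
  rw [ZMod.natCast_self, add_zero] at this
  rw [this]
  omega

theorem isMaximalInterval (h : IsTwoPeak I p a b c d) : IsMaximalInterval I p a := by
  have h1 := h.sum
  have h2 := h.hb
  refine ⟨h.ha, h.self_notMem, fun s hs => ?_, ?_⟩
  · rw [Finset.mem_Icc] at hs
    rw [h.mem s hs.1 (by omega)]
    exact Or.inl hs.2
  · rw [h.mem _ (by omega) (by omega)]
    omega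

theorem _root_.CircularAlgebra.IsMaximalInterval.unique {l l' : ℕ} (h : IsMaximalInterval I p l)
    (h' : IsMaximalInterval I p l') : l = l' := by
  have key : ∀ {l l' : ℕ}, IsMaximalInterval I p l → IsMaximalInterval I p l' → l' ≤ l := by
    intro l l' h h'
    by_contra hl
    exact h.2.2.2 (h'.2.2.1 _ (Finset.mem_Icc.2 ⟨by omega, by omega⟩))
  exact le_antisymm (key h' h) (key h h')

/-- A maximal interval starts right after a peak, and the only peaks are `p` and `p + a + b`. -/
theorem eq_of_isMaximalInterval (h : IsTwoPeak I p a b c d) {q : ZMod n} {l : ℕ}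
    (hq : IsMaximalInterval I q l) : l = a ∨ l = c := by
  have h1 := h.sum
  obtain ⟨s, hs, hs', rfl⟩ := exists_add_natCast p q
  have h2 := hq.2.1
  have h3 := hq.2.2.1 1 (Finset.mem_Icc.2 ⟨le_rfl, hq.1⟩)
  rw [h.mem s hs hs'] at h2
  rw [add_add_natCast] at h3
  rcases hs'.lt_or_eq with hlt | rfl
  · rw [h.mem _ (by omega) hlt] at h3
    obtain rfl : s = a + b := by omega
    exact Or.inr (hq.unique h.rotate.isMaximalInterval)
  · rw [ZMod.natCast_self, add_zero] at hq
    exact Or.inl (hq.unique h.isMaximalInterval)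

theorem slopeLengths_eq (h : IsTwoPeak I p a b c d) : slopeLengths I = {a, b, c, d} := by
  ext l
  simp only [slopeLengths, Set.mem_ofPred_eq, Set.mem_insert_iff, Set.mem_singleton_iff]
  constructor
  · rintro ⟨q, hq | hq⟩
    · rcases h.eq_of_isMaximalInterval hq with h | h <;> simp [h]
    · rcases h.compl.eq_of_isMaximalInterval hq with h | h <;> simp [h]
  · rintro (rfl | rfl | rfl | rfl)
    · exact ⟨_, Or.inl h.isMaximalInterval⟩
    · exact ⟨_, Or.inr h.compl.isMaximalInterval⟩
    · exact ⟨_, Or.inl h.rotate.isMaximalInterval⟩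
    · exact ⟨_, Or.inr h.compl.rotate.isMaximalInterval⟩

theorem minSlope_eq (h : IsTwoPeak I p a b c d) : minSlope I = min (min b c) (min d a) := by
  rw [minSlope, h.slopeLengths_eq]
  refine IsLeast.csInf_eq ⟨?_, ?_⟩
  · simp only [Set.mem_insert_iff, Set.mem_singleton_iff]
    omega
  · rintro l (rfl | rfl | rfl | rfl) <;> omega

end IsTwoPeak

/-- The part of the rim between two consecutive peaks. -/
theorem exists_slope_of_peaks {I : Finset (ZMod n)} {p q : ZMod n} (hpq : p ≠ q)
    (h : peaks I = {p, q}) : ∃ a : ℕ, 0 < a ∧ a < (q - p).val ∧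
      ∀ s : ℕ, 1 ≤ s → s ≤ (q - p).val → (p + (s : ZMod n) ∈ I ↔ s ≤ a) := by
  have hmem : ∀ i, (i ∉ I ∧ i + 1 ∈ I) ↔ i = p ∨ i = q := by
    intro i
    have : i ∈ peaks I ↔ i = p ∨ i = q := by rw [h]; simp
    simpa [peaks] using this
  have he : (q - p).val < n := ZMod.val_lt _
  have hq : p + ((q - p).val : ZMod n) = q := by rw [ZMod.natCast_zmod_val, add_sub_cancel]
  generalize (q - p).val = e at he hq
  have hp1 := (hmem p).2 (Or.inl rfl)
  have hq1 := (hmem q).2 (Or.inr rfl)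
  have he0 : e ≠ 0 := by
    rintro rfl
    exact hpq (by simpa using hq)
  have hex : ∃ s : ℕ, p + ((s + 1 : ℕ) : ZMod n) ∉ I :=
    ⟨e - 1, by rw [Nat.sub_add_cancel (by omega), hq]; exact hq1.1⟩
  -- The slope ends just before the first edge outside `I`, found among the edges up to `q`, since
  -- `q` itself lies outside `I`.
  have ha := Nat.find_spec hex
  have hmin := fun m (hm : m < Nat.find hex) => not_not.1 (Nat.find_min hex hm)
  generalize Nat.find hex = a at ha hmin
  have ha0 : 0 < a := by
    by_contra h0
    obtain rfl : a = 0 := by omega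
    exact ha (by simpa using hp1.2)
  have hlt : a < e := by
    by_contra hle
    refine hq1.1 ?_
    rw [← hq]
    have := hmin (e - 1) (by omega)
    rwa [Nat.sub_add_cancel (by omega)] at this
  -- Re-entering `I` before reaching `q` would create a peak strictly between `p` and `q`.
  have hup : ∀ s : ℕ, a + 1 + s ≤ e → p + ((a + 1 + s : ℕ) : ZMod n) ∉ I := by
    intro s
    induction s with
    | zero => exact fun _ => ha
    | succ s ih =>
      intro hs hin
      have h1 : p + ((a + 1 + s : ℕ) : ZMod n) + 1 ∈ I := by
        have h2 : p + ((a + 1 + (s + 1) : ℕ) : ZMod n) = p + ((a + 1 + s : ℕ) : ZMod n) + 1 := by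
          push_cast; ring
        rwa [← h2]
      rcases (hmem _).1 ⟨ih (by omega), h1⟩ with h3 | h3
      · have h4 : p + ((a + 1 + s : ℕ) : ZMod n) = p + (n : ZMod n) := by
          rw [h3, ZMod.natCast_self, add_zero]
        have := add_natCast_injOn p (by omega) (by omega) (by omega) le_rfl h4
        omega
      · rw [← hq] at h3
        have := add_natCast_injOn p (by omega) (by omega) (by omega) he.le h3
        omega
  refine ⟨a, ha0, hlt, fun s hs hs' => ⟨fun hin => ?_, fun hsa => ?_⟩⟩
  · by_contra hsa
    refine hup (s - a - 1) (by omega) ?_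
    rwa [show a + 1 + (s - a - 1) = s by omega]
  · have := hmin (s - 1) (by omega)
    rwa [Nat.sub_add_cancel hs] at this

/-- The two peaks cut the cycle into arcs of lengths `e` and `n - e`, each made of one slope in `I`
followed by one outside it. -/
theorem exists_isTwoPeak {I : Finset (ZMod n)} (h : (peaks I).card = 2) :
    ∃ p a b c d, IsTwoPeak I p a b c d := by
  obtain ⟨p, q, hpq, h⟩ := Finset.card_eq_two.1 h
  obtain ⟨a, ha, hae, hI⟩ := exists_slope_of_peaks hpq h
  obtain ⟨c, hc, hce, hI'⟩ := exists_slope_of_peaks hpq.symm (h.trans (Finset.pair_comm p q))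
  have he : (q - p).val < n := ZMod.val_lt _
  have hq : p + ((q - p).val : ZMod n) = q := by rw [ZMod.natCast_zmod_val, add_sub_cancel]
  have hne : NeZero (q - p) := ⟨sub_ne_zero.2 hpq.symm⟩
  have hv : (p - q).val = n - (q - p).val := by
    rw [← neg_sub, ZMod.val_neg_of_ne_zero]
  rw [hv] at hce hI'
  generalize (q - p).val = e at *
  refine ⟨p, a, e - a, c, n - e - c, ha, by omega, hc, by omega, by omega, fun s hs hs' => ?_⟩
  rw [Nat.add_sub_cancel' hae.le]
  by_cases hse : s ≤ e
  · rw [hI s hs hse]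
    omega
  · have := hI' (s - e) (by omega) (by omega)
    rw [← hq, add_add_natCast, Nat.add_sub_cancel' (by omega)] at this
    rw [this]
    omega

/-- The rim with slopes of lengths `a`, `b`, `c`, clockwise from the peak `p`. -/
def twoPeak (p : ZMod n) (a b c : ℕ) : Finset (ZMod n) :=
  {i | (i - p - 1).val + 1 ≤ a ∨ (a + b < (i - p - 1).val + 1 ∧ (i - p - 1).val + 1 ≤ a + b + c)}

theorem isTwoPeak_twoPeak (p : ZMod n) {a b c d : ℕ} (ha : 0 < a) (hb : 0 < b) (hc : 0 < c)
    (hd : 0 < d) (h : a + b + c + d = n) : IsTwoPeak (twoPeak p a b c) p a b c d := by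
  refine ⟨ha, hb, hc, hd, h, fun s hs hs' => ?_⟩
  have : (p + (s : ZMod n) - p - 1).val = s - 1 := by
    rw [add_sub_cancel_left, show (s : ZMod n) - 1 = ((s - 1 : ℕ) : ZMod n) by
      rw [Nat.cast_sub hs]; simp, ZMod.val_cast_of_lt (by omega)]
  rw [twoPeak, Finset.mem_filter_univ, this, Nat.sub_add_cancel hs]

/-- Summing the defining equation around the cycle cancels the degrees. -/
theorem IsDegree.card_eq {A C : Finset (ZMod n)} {e : ZMod n → ℕ} (h : IsDegree A C e) :
    A.card = C.card := by
  have h1 : ∑ i, (e i + if i ∈ A then 0 else 1) = ∑ i, (e (i - 1) + if i ∈ C then 0 else 1) :=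
    Finset.sum_congr rfl fun i _ => h i
  have h2 : ∑ i, e (i - 1) = ∑ i, e i :=
    Fintype.sum_equiv (Equiv.subRight 1) _ _ (fun _ => rfl)
  rw [Finset.sum_add_distrib, Finset.sum_add_distrib, h2, add_right_inj] at h1
  have h3 : ∀ S : Finset (ZMod n), (∑ i, if i ∈ S then 0 else 1) + S.card = n := by
    intro S
    have : ∀ i : ZMod n, (if i ∈ S then 0 else 1) = if i ∈ Sᶜ then 1 else 0 := by
      intro i
      by_cases hi : i ∈ S <;> simp [hi]
    simp only [this]
    rw [Finset.sum_ite_mem, Finset.univ_inter, Finset.sum_const, smul_eq_mul, mul_one,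
      Finset.card_compl, ZMod.card]
    have := Finset.card_le_univ S
    rw [ZMod.card] at this
    omega
  have h4 := h3 A
  have h5 := h3 C
  omega

/-- The degree at `i` of the minimal homomorphism from the projective module at the peak `p`. -/
def degPeak (p : ZMod n) (a b c : ℕ) (i : ZMod n) : ℕ :=
  min (min ((i - p).val - a) (a + b + c - (i - p).val)) (min b c)

theorem degPeak_le (p : ZMod n) (a b c : ℕ) (i : ZMod n) : degPeak p a b c i ≤ min b c :=
  min_le_right _ _

theorem degPeak_add (p : ZMod n) {a b c s : ℕ} (h : a + b + c ≤ n) (hs : s ≤ n) :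
    degPeak p a b c (p + (s : ZMod n)) = min (min (s - a) (a + b + c - s)) (min b c) := by
  rw [degPeak, add_sub_cancel_left]
  rcases hs.lt_or_eq with h1 | rfl
  · rw [ZMod.val_cast_of_lt h1]
  -- At `s = n` the value wraps to `0`; truncated subtraction makes both sides vanish.
  · rw [ZMod.natCast_self, ZMod.val_zero]
    omega

/-! ### Degree functions and divisibility for two-peak rims -/

namespace IsTwoPeak

variable {I : Finset (ZMod n)} {p : ZMod n} {a b c d : ℕ}

theorem degPeak_peak (h : IsTwoPeak I p a b c d) :
    degPeak p a b c (p + ((a + b : ℕ) : ZMod n)) = min b c := by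
  have := h.sum
  rw [degPeak_add p (by omega) (by omega)]
  omega

/-- The graph of the degree is a trapezoid: zero up to the valley `p + a`, rising with slope one to
`min b c`, flat, and back to zero at the valley `p + a + b + c`. It rises on the edges of the
interval outside `I` and falls on those of `I` outside the interval. -/
theorem degPeak_isDegree (h : IsTwoPeak I p a b c d) :
    IsDegree (interval p (a + c)) I (degPeak p a b c) := by
  intro i
  have h1 := h.sum
  obtain ⟨s, hs, hs', rfl⟩ := exists_add_natCast p i
  rw [add_succ_sub_one p hs, degPeak_add p (by omega) hs', degPeak_add p (by omega) (by omega)]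
  simp only [add_mem_interval p (show a + c ≤ n by omega) hs hs', h.mem s hs hs']
  split_ifs <;> omega

theorem card_eq (h : IsTwoPeak I p a b c d) : I.card = a + c := by
  rw [← h.degPeak_isDegree.card_eq, card_interval]
  have := h.sum
  omega

/-- The two supports lie strictly inside the two complementary arcs bounded by the valleys. -/
theorem degPeak_disjoint (h : IsTwoPeak I p a b c d) (i : ZMod n) :
    degPeak p a b c i = 0 ∨ degPeak (p + ((a + b : ℕ) : ZMod n)) c d a i = 0 := by
  have h1 := h.sum
  obtain ⟨s, hs, hs', rfl⟩ := exists_add_natCast p i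
  rw [degPeak_add p (by omega) hs', add_natCast_eq_rotate p (s := s) (show a + b ≤ n by omega),
    degPeak_add _ (by omega) (by split_ifs <;> omega)]
  split_ifs <;> omega

/-- Counted with multiplicity, `I` and `J` together cover the same edges as the intervals at the two
peaks: each interval is a slope of `I` followed by a slope of `J`. So `J` minus the second interval
equals the first interval minus `I`, and the same exponents serve. -/
theorem degPeak_isDegree_syzygy {J : Finset (ZMod n)} (h : IsTwoPeak I p a b c d)
    (hJ : IsTwoPeak J (p + (a : ZMod n)) c b a d) :
    IsDegree J (interval (p + ((a + b : ℕ) : ZMod n)) (a + c)) (degPeak p a b c) := by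
  intro i
  have h1 := h.sum
  obtain ⟨s, hs, hs', rfl⟩ := exists_add_natCast p i
  rw [add_succ_sub_one p hs, degPeak_add p (by omega) hs', degPeak_add p (by omega) (by omega)]
  have h2 := hJ.mem (if a < s then s - a else s + n - a) (by split_ifs <;> omega)
    (by split_ifs <;> omega)
  rw [← add_natCast_eq_rotate p (show a ≤ n by omega)] at h2
  have h3 := add_mem_interval (p + ((a + b : ℕ) : ZMod n)) (show a + c ≤ n by omega)
    (s := if a + b < s then s - (a + b) else s + n - (a + b)) (by split_ifs <;> omega)
    (by split_ifs <;> omega)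
  rw [← add_natCast_eq_rotate p (show a + b ≤ n by omega)] at h3
  simp only [h2, h3]
  split_ifs <;> omega

/-- A homomorphism from the projective module at the valley `p + a` is divisible by `t` away from
this valley. -/
theorem X_dvd_of_isFamily (h : IsTwoPeak I p a b c d) {k : ℕ} (hk : 0 < k) (hkn : k < n)
    {g : ZMod n → ℂ⟦X⟧} (hg : IsFamily (interval (p + (a : ZMod n)) k) I g) {i : ZMod n}
    (hi : i ≠ p + (a : ZMod n)) : PowerSeries.X ∣ g i := by
  have h1 := h.sum
  have ha := h.ha
  have hb := h.hb
  -- On the interval every `x` acts on the projective as `1`. The first edge after the valley is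
  -- outside `I`, so a factor `t` appears at once and then persists.
  have hup : ∀ s : ℕ, 1 ≤ s → s ≤ k →
      PowerSeries.X ∣ g (p + (a : ZMod n) + (s : ZMod n)) := by
    intro s hs hsk
    have h2 := hg (p + (a : ZMod n) + (s : ZMod n))
    rw [xCoeff, if_pos ((add_mem_interval _ hkn.le hs (by omega)).2 hsk), mul_one,
      add_succ_sub_one _ hs] at h2
    rw [h2]
    induction s, hs using Nat.le_induction with
    | base =>
      refine Dvd.dvd.mul_right ?_ _
      rw [xCoeff, if_neg]
      rw [add_add_natCast, h.mem _ (by omega) (by omega)]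
      omega
    | succ s hs ih =>
      refine Dvd.dvd.mul_left ?_ _
      have h3 := hg (p + (a : ZMod n) + (s : ZMod n))
      rw [xCoeff, if_pos ((add_mem_interval _ hkn.le hs (by omega)).2 (by omega)), mul_one,
        add_succ_sub_one _ hs] at h3
      rw [Nat.add_sub_cancel, h3]
      exact ih (by omega) h3
  -- Backwards from the valley, outside the interval, the same happens with `y`: the edge `p + a`
  -- itself belongs to `I` and contributes `t`.
  have hdown : ∀ s : ℕ, s + k + 1 ≤ n →
      PowerSeries.X ∣ g (p + (a : ZMod n) + ((n - 1 - s : ℕ) : ZMod n)) := by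
    intro s
    have h4 : ∀ s, s + k + 1 ≤ n → g (p + (a : ZMod n) + ((n - 1 - s : ℕ) : ZMod n)) =
        yCoeff I (p + (a : ZMod n) + ((n - s : ℕ) : ZMod n)) *
          g (p + (a : ZMod n) + ((n - s : ℕ) : ZMod n)) := by
      intro s hs
      have h2 := hg.yCoeff (p + (a : ZMod n) + ((n - s : ℕ) : ZMod n))
      rw [yCoeff, if_neg, mul_one, add_succ_sub_one _ (by omega)] at h2
      · rwa [show n - 1 - s = n - s - 1 by omega]
      · rw [add_mem_interval _ hkn.le (by omega) (by omega)]
        omega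
    induction s with
    | zero =>
      intro hs
      rw [h4 0 hs]
      refine Dvd.dvd.mul_right ?_ _
      rw [yCoeff, if_pos]
      rw [Nat.sub_zero, ZMod.natCast_self, add_zero, h.mem _ (by omega) (by omega)]
      omega
    | succ s ih =>
      intro hs
      rw [h4 _ hs]
      refine Dvd.dvd.mul_left ?_ _
      rw [show n - (s + 1) = n - 1 - s by omega]
      exact ih (by omega)
  obtain ⟨s, hs, hs', rfl⟩ := exists_add_natCast (p + (a : ZMod n)) i
  have hsn : s ≠ n := by
    rintro rfl
    exact hi (by rw [ZMod.natCast_self, add_zero])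
  by_cases hsk : s ≤ k
  · exact hup s hs hsk
  · have := hdown (n - 1 - s) (by omega)
    rwa [show n - 1 - (n - 1 - s) = s by omega] at this

end IsTwoPeak

end

/-! ## Computing `Ext¹` from a projective presentation -/

section

universe w v u t

variable {R : Type t} [CommRing R] {C : Type u} [Category.{v} C] [Abelian C] [Linear R C]
  [HasExt.{w} C]

/-- The connecting map on the multiples of a morphism out of the first syzygy. -/
def connecting (R : Type t) [CommRing R] [Linear R C] {S : ShortComplex C} (hS : S.ShortExact)
    {N : C} (f : S.X₁ ⟶ N) : R →ₗ[R] Abelian.Ext.{w} S.X₃ N 1 :=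
  LinearMap.toSpanSingleton R _ (hS.extClass.comp (Abelian.Ext.mk₀ f) (add_zero 1))

theorem connecting_apply {S : ShortComplex C} (hS : S.ShortExact) {N : C} (f : S.X₁ ⟶ N) (r : R) :
    connecting R hS f r = hS.extClass.comp (Abelian.Ext.mk₀ (r • f)) (add_zero 1) := by
  rw [connecting, LinearMap.toSpanSingleton_apply, Abelian.Ext.mk₀_smul, Abelian.Ext.comp_smul]

/-- Exactness of the long exact `Ext` sequence at `Hom(S.X₁, N)`. -/
theorem connecting_eq_zero_iff {S : ShortComplex C} (hS : S.ShortExact) {N : C} (f : S.X₁ ⟶ N)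
    (r : R) : connecting R hS f r = 0 ↔ ∃ g : S.X₂ ⟶ N, S.f ≫ g = r • f := by
  rw [connecting_apply]
  constructor
  · intro h
    obtain ⟨x, hx⟩ := Abelian.Ext.contravariant_sequence_exact₁ hS N _ (add_zero 1) h
    obtain ⟨g, rfl⟩ := Abelian.Ext.addEquiv₀.symm.surjective x
    refine ⟨g, ?_⟩
    rw [Abelian.Ext.addEquiv₀_symm_apply, Abelian.Ext.mk₀_comp_mk₀] at hx
    exact Abelian.Ext.addEquiv₀.symm.injective hx
  · rintro ⟨g, hg⟩
    rw [← hg, ← Abelian.Ext.mk₀_comp_mk₀, hS.extClass_comp_assoc]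

theorem connecting_surjective {S : ShortComplex C} (hS : S.ShortExact) [Projective S.X₂] {N : C}
    (f : S.X₁ ⟶ N) (hf : ∀ f' : S.X₁ ⟶ N, ∃ r : R, f' = r • f) :
    Function.Surjective (connecting.{w} R hS f) := by
  intro x
  obtain ⟨y, rfl⟩ := Abelian.Ext.contravariant_sequence_exact₃ hS N x
    (Abelian.Ext.eq_zero_of_projective _) (add_zero 1)
  obtain ⟨f', rfl⟩ := Abelian.Ext.addEquiv₀.symm.surjective y
  obtain ⟨r, rfl⟩ := hf f'
  exact ⟨r, connecting_apply hS f r⟩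

/-- If the morphisms out of the first syzygy are the multiples of `f`, then `Ext¹` is the quotient
of the scalars by those for which the multiple of `f` extends to the projective. -/
def extEquivQuotient {S : ShortComplex C} (hS : S.ShortExact) [Projective S.X₂] {N : C}
    (f : S.X₁ ⟶ N) (hf : ∀ f' : S.X₁ ⟶ N, ∃ r : R, f' = r • f) (𝔞 : Ideal R)
    (h𝔞 : LinearMap.ker (connecting.{w} R hS f) = 𝔞) :
    Abelian.Ext.{w} S.X₃ N 1 ≃ₗ[R] R ⧸ 𝔞 :=
  ((Submodule.quotEquivOfEq _ _ h𝔞.symm).trans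
    ((connecting.{w} R hS f).quotKerEquivOfSurjective (connecting_surjective hS f hf))).symm

/-- A scalar that factors through a projective annihilates `Ext¹`. -/
theorem smul_ext_eq_zero {M N P : C} [Projective P] (r : R) (α : M ⟶ P) (β : P ⟶ M)
    (h : α ≫ β = r • 𝟙 M) (x : Abelian.Ext.{w} M N 1) : r • x = 0 := by
  have h1 : r • x = (Abelian.Ext.mk₀ (r • 𝟙 M)).comp x (zero_add 1) := by
    rw [Abelian.Ext.mk₀_smul, Abelian.Ext.smul_comp, Abelian.Ext.mk₀_id_comp]
  rw [h1, ← h, ← Abelian.Ext.mk₀_comp_mk₀, Abelian.Ext.comp_assoc _ _ _ (zero_add 0) (zero_add 1)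
    (by simp), Abelian.Ext.eq_zero_of_projective ((Abelian.Ext.mk₀ β).comp x (zero_add 1)),
    Abelian.Ext.comp_zero]

/-- `Ext` is invariant under isomorphism in the second variable. -/
def extCongrRight (R : Type t) [CommRing R] [Linear R C] (M : C) {N N' : C} (e : N ≅ N') (m : ℕ) :
    Abelian.Ext.{w} M N m ≃ₗ[R] Abelian.Ext.{w} M N' m :=
  LinearEquiv.ofLinearMap
    (Abelian.Ext.postcompOfLinear (Abelian.Ext.mk₀ e.hom) R M (add_zero m))
    (Abelian.Ext.postcompOfLinear (Abelian.Ext.mk₀ e.inv) R M (add_zero m))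
    (by ext x; simp) (by ext x; simp)

/-- `Ext` is invariant under isomorphism in the first variable. -/
def extCongrLeft (R : Type t) [CommRing R] [Linear R C] (N : C) {M M' : C} (e : M ≅ M') (m : ℕ) :
    Abelian.Ext.{w} M N m ≃ₗ[R] Abelian.Ext.{w} M' N m :=
  LinearEquiv.ofLinearMap
    (Abelian.Ext.precompOfLinear (Abelian.Ext.mk₀ e.inv) R N (zero_add m))
    (Abelian.Ext.precompOfLinear (Abelian.Ext.mk₀ e.hom) R N (zero_add m))
    (by ext x; simp) (by ext x; simp)

end

/-! ## Uniqueness of projective covers -/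

section

variable {R : Type} [Ring R] {M P P' : ModuleCat.{0} R} {π : P ⟶ M} {π' : P' ⟶ M}

/-- A lift `f` of `π` through `π'` is onto because the kernel of `π'` is superfluous. It splits
since `P'` is projective, and its section is onto because the kernel of `π` is superfluous. -/
theorem IsProjectiveCover.exists_equiv (h : IsProjectiveCover π) (h' : IsProjectiveCover π') :
    ∃ e : P ≃ₗ[R] P', π'.hom ∘ₗ e.toLinearMap = π.hom := by
  obtain ⟨hP, hπ, hker⟩ := h
  obtain ⟨hP', hπ', hker'⟩ := h'
  obtain ⟨f, hf⟩ := Module.projective_lifting_property π'.hom π.hom hπ'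
  have hf' : ∀ x, π'.hom (f x) = π.hom x := fun x => LinearMap.congr_fun hf x
  have hsurj : LinearMap.range f = ⊤ := by
    refine hker' _ (eq_top_iff.2 fun y _ => ?_)
    obtain ⟨x, hx⟩ := hπ (π'.hom y)
    refine Submodule.mem_sup.2 ⟨f x, ⟨x, rfl⟩, y - f x, ?_, add_sub_cancel _ _⟩
    rw [LinearMap.mem_ker, map_sub, hf', hx, sub_self]
  obtain ⟨s, hs⟩ := Module.projective_lifting_property f LinearMap.id (LinearMap.range_eq_top.1 hsurj)
  have hs' : ∀ y, f (s y) = y := fun y => LinearMap.congr_fun hs y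
  have hsurj' : LinearMap.range s = ⊤ := by
    refine hker _ (eq_top_iff.2 fun x _ => ?_)
    refine Submodule.mem_sup.2 ⟨s (f x), ⟨f x, rfl⟩, x - s (f x), ?_, add_sub_cancel _ _⟩
    rw [LinearMap.mem_ker, map_sub, ← hf', ← hf', hs', sub_self]
  refine ⟨LinearEquiv.ofLinearMap f s hs ?_, hf⟩
  refine LinearMap.ext fun x => ?_
  obtain ⟨y, rfl⟩ := LinearMap.range_eq_top.1 hsurj' x
  rw [LinearMap.comp_apply, hs', LinearMap.id_apply]

theorem IsProjectiveCover.nonempty_ker_equiv (h : IsProjectiveCover π)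
    (h' : IsProjectiveCover π') :
    Nonempty (LinearMap.ker π.hom ≃ₗ[R] LinearMap.ker π'.hom) := by
  obtain ⟨e, he⟩ := h.exists_equiv h'
  refine ⟨e.ofSubmodules _ _ ?_⟩
  rw [← he, LinearMap.ker_comp, Submodule.map_comap_eq_of_surjective e.surjective]

end

/-- A linear map as a morphism of modules. -/
def linearHom {R : Type} [Ring R] {M N : ModuleCat.{0} R} (f : M →ₗ[R] N) : M ⟶ N :=
  ModuleCat.ofHom f

@[simp] theorem hom_linearHom {R : Type} [Ring R] {M N : ModuleCat.{0} R} (f : M →ₗ[R] N) :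
    (linearHom f).hom = f := rfl

theorem projective_moduleCat {R : Type} [Ring R] (P : ModuleCat.{0} R) (hP : Module.Projective R P) :
    Projective P :=
  (IsProjective.iff_projective P).1 hP

/-! ## The projective cover of a rank one module with two peaks -/

section

variable {k n : ℕ} [NeZero n] {A C D : Finset (ZMod n)} {hA : A.card = k} {hC : C.card = k}
  {hD : D.card = k} {hk : 0 < k} {hkn : k < n}

theorem IsFamily.mul {g h : ZMod n → ℂ⟦X⟧} (hg : IsFamily A C g) (hh : IsFamily C D h) :
    IsFamily A D (fun i => h i * g i) := by
  intro i
  linear_combination h i * hg i + g (i - 1) * hh i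

theorem IsFamily.const {g : ZMod n → ℂ⟦X⟧} (hg : IsFamily A A g) (i j : ZMod n) : g i = g j := by
  have hd : IsDegree A A (fun _ => 0) := fun i => rfl
  simpa using hg.eq_mul_pow hd (i := j) rfl i

theorem familyOf_smul (z : ℂ⟦X⟧) (φ : rankOne A hA hk hkn ⟶ rankOne C hC hk hkn) (i : ZMod n) :
    familyOf (z • φ).hom i = z * familyOf φ.hom i := by
  change toLattice C hC hk hkn (algebraMap ℂ⟦X⟧ (B k n) z • φ.hom _) i = _
  rw [toLattice_algebraMap_smul]
  rfl

theorem familyOf_id (i : ZMod n) :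
    familyOf (LinearMap.id : rankOne A hA hk hkn →ₗ[B k n] rankOne A hA hk hkn) i = 1 :=
  Pi.single_eq_same (M := fun _ : ZMod n => ℂ⟦X⟧) i 1

theorem rankOne_hom_ext {φ ψ : rankOne A hA hk hkn ⟶ rankOne C hC hk hkn}
    (h : ∀ i, familyOf φ.hom i = familyOf ψ.hom i) : φ = ψ :=
  ModuleCat.hom_ext (hom_ext (funext h))

/-- The homomorphisms between two rank one modules form a free `Z`-module of rank one. -/
theorem exists_smul_of_isDegree {d : ZMod n → ℕ} (hd : IsDegree A C d) {i₀ : ZMod n}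
    (hi₀ : d i₀ = 0) (φ : rankOne A hA hk hkn ⟶ rankOne C hC hk hkn) :
    ∃ z : ℂ⟦X⟧, φ = z • (linearHom (homOfFamily hd.isFamily) :
      rankOne A hA hk hkn ⟶ rankOne C hC hk hkn) := by
  refine ⟨familyOf φ.hom i₀, rankOne_hom_ext fun i => ?_⟩
  rw [familyOf_smul, hom_linearHom, familyOf_homOfFamily]
  exact (isFamily_familyOf φ.hom).eq_mul_pow hd hi₀ i

end

/-- The combinatorial data of the projective resolution of `L_I`, for a rim `I` with the peaks `p`
and `q`: the exponents `dp` and `dq` of the minimal homomorphisms from the projective modules at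
`p` and `q` to `L_I`, and the rim `J` of the kernel. -/
structure IsResolution {n : ℕ} (k : ℕ) [NeZero n] (I J : Finset (ZMod n)) (p q : ZMod n)
    (dp dq : ZMod n → ℕ) : Prop where
  degp : IsDegree (interval p k) I dp
  degq : IsDegree (interval q k) I dq
  degq' : IsDegree J (interval p k) dq
  degp' : IsDegree J (interval q k) dp
  disjoint : ∀ i, dp i = 0 ∨ dq i = 0
  posp : 0 < dp q
  posq : 0 < dq p
  lep : ∀ i, dp i ≤ dp q
  leq : ∀ i, dq i ≤ dq p

/-- The conditions on `dq` are those on `dp` seen from the other peak: from there the next peak is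
`p`, and `J` has to be read from its other peak. -/
theorem IsTwoPeak.isResolution {n k : ℕ} [NeZero n] {I J : Finset (ZMod n)} {p : ZMod n}
    {a b c d : ℕ} (h : IsTwoPeak I p a b c d) (hJ : IsTwoPeak J (p + (a : ZMod n)) c b a d)
    (hk : I.card = k) : IsResolution k I J p (p + ((a + b : ℕ) : ZMod n)) (degPeak p a b c)
      (degPeak (p + ((a + b : ℕ) : ZMod n)) c d a) := by
  have hk1 : a + c = k := by rw [← hk, h.card_eq]
  have hk2 : c + a = k := by rw [← hk1, add_comm]
  have hr := h.rotate.degPeak_peak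
  have h1 := h.sum
  have hp : p + ((a + b : ℕ) : ZMod n) + ((c + d : ℕ) : ZMod n) = p := by
    rw [add_add_natCast, show a + b + (c + d) = n by omega, ZMod.natCast_self, add_zero]
  have hJ' : IsTwoPeak J (p + ((a + b : ℕ) : ZMod n) + (c : ZMod n)) a d c b := by
    have := hJ.rotate
    rwa [add_add_natCast, show a + (c + b) = a + b + c by omega, ← add_add_natCast] at this
  have hs := h.rotate.degPeak_isDegree_syzygy hJ'
  rw [hp] at hr hs
  have := h.ha
  have := h.hb
  have := h.hc
  have := h.hd
  refine ⟨hk1 ▸ h.degPeak_isDegree, hk2 ▸ h.rotate.degPeak_isDegree, hk2 ▸ hs,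
    hk1 ▸ h.degPeak_isDegree_syzygy hJ, h.degPeak_disjoint, ?_, ?_, fun i => ?_, fun i => ?_⟩
  · rw [h.degPeak_peak]
    omega
  · rw [hr]
    omega
  · rw [h.degPeak_peak]
    exact degPeak_le _ _ _ _ _
  · rw [hr]
    exact degPeak_le _ _ _ _ _

/-! ### The projective presentation, the syzygy and the `Ext¹` groups -/

namespace IsResolution

variable {k n : ℕ} [NeZero n] {I J : Finset (ZMod n)} {p q : ZMod n} {dp dq : ZMod n → ℕ}
  (h : IsResolution k I J p q dp dq) (hI : I.card = k) (hJ : J.card = k) (hk : 0 < k) (hkn : k < n)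

/-- The projective module `B eₚ ⊕ B e_q`. -/
abbrev proj (hk : 0 < k) (hkn : k < n) (p q : ZMod n) : ModuleCat.{0} (B k n) :=
  ModuleCat.of (B k n) (projAt hk hkn p × projAt hk hkn q)

/-- The projective cover of `L_I`. -/
def π : projAt hk hkn p × projAt hk hkn q →ₗ[B k n] rankOne I hI hk hkn :=
  LinearMap.coprod (homOfFamily h.degp.isFamily) (homOfFamily h.degq.isFamily)

/-- The inclusion of the kernel of the projective cover. -/
def ι : rankOne J hJ hk hkn →ₗ[B k n] projAt hk hkn p × projAt hk hkn q :=
  LinearMap.prod (homOfFamily h.degq'.isFamily) (-homOfFamily h.degp'.isFamily)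

theorem toLattice_π (u : projAt hk hkn p) (v : projAt hk hkn q) (i : ZMod n) :
    toLattice I hI hk hkn (h.π hI hk hkn (u, v)) i =
      PowerSeries.X ^ dp i * toLattice _ _ hk hkn u i +
        PowerSeries.X ^ dq i * toLattice _ _ hk hkn v i := rfl

theorem π_ι (w : rankOne J hJ hk hkn) : h.π hI hk hkn (h.ι hJ hk hkn w) = 0 := by
  refine (toLattice I hI hk hkn).injective (funext fun i => ?_)
  refine (h.toLattice_π hI hk hkn _ _ i).trans ?_
  change PowerSeries.X ^ dp i * (PowerSeries.X ^ dq i * toLattice _ _ hk hkn w i) +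
    PowerSeries.X ^ dq i * (-(PowerSeries.X ^ dp i * toLattice _ _ hk hkn w i)) = (0 : ℂ⟦X⟧)
  ring

theorem ι_injective : Function.Injective (h.ι hJ hk hkn) := by
  rw [injective_iff_map_eq_zero]
  intro w hw
  refine (toLattice J hJ hk hkn).injective (funext fun i => ?_)
  change toLattice J hJ hk hkn w i = (0 : ℂ⟦X⟧)
  have h1 : PowerSeries.X ^ dq i * toLattice J hJ hk hkn w i = 0 :=
    congrFun (congrArg Prod.fst hw) i
  exact (mul_eq_zero.1 h1).resolve_left (pow_ne_zero _ PowerSeries.X_ne_zero)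

/-- At every vertex one of the two exponents is zero, so one summand alone already reaches
everything. -/
theorem π_surjective : Function.Surjective (h.π hI hk hkn) := by
  intro w
  refine ⟨((toLattice _ _ hk hkn).symm fun i => if dp i = 0 then toLattice I hI hk hkn w i else 0,
    (toLattice _ _ hk hkn).symm fun i => if dp i = 0 then 0 else toLattice I hI hk hkn w i), ?_⟩
  refine (toLattice I hI hk hkn).injective (funext fun i => ?_)
  rw [toLattice_π, AddEquiv.apply_symm_apply, AddEquiv.apply_symm_apply]
  split_ifs with h0
  · rw [h0, pow_zero, one_mul, mul_zero, add_zero]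
  · rw [(h.disjoint i).resolve_left h0, pow_zero, one_mul, mul_zero, zero_add]

theorem exists_ι_eq (x : projAt hk hkn p × projAt hk hkn q) (hx : h.π hI hk hkn x = 0) :
    ∃ w, h.ι hJ hk hkn w = x := by
  obtain ⟨u, v⟩ := x
  have h1 : ∀ i, PowerSeries.X ^ dp i * toLattice _ _ hk hkn u i +
      PowerSeries.X ^ dq i * toLattice _ _ hk hkn v i = 0 := fun i =>
    congrFun (congrArg (toLattice I hI hk hkn) hx) i
  refine ⟨(toLattice J hJ hk hkn).symm fun i =>
    if dp i = 0 then -toLattice _ _ hk hkn v i else toLattice _ _ hk hkn u i, ?_⟩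
  refine Prod.ext ((toLattice _ _ hk hkn).injective (funext fun i => ?_))
    ((toLattice _ _ hk hkn).injective (funext fun i => ?_))
  · change PowerSeries.X ^ dq i * (if dp i = 0 then -toLattice _ _ hk hkn v i
      else toLattice _ _ hk hkn u i) = _
    have := h1 i
    split_ifs with h0
    · rw [h0, pow_zero, one_mul] at this
      linear_combination -this
    · rw [(h.disjoint i).resolve_left h0, pow_zero, one_mul]
  · change -(PowerSeries.X ^ dp i * (if dp i = 0 then -toLattice _ _ hk hkn v i
      else toLattice _ _ hk hkn u i)) = _
    have := h1 i
    split_ifs with h0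
    · rw [h0, pow_zero, one_mul, neg_neg]
    · rw [(h.disjoint i).resolve_left h0, pow_zero, one_mul] at this
      linear_combination -this

theorem ker_π : LinearMap.ker (h.π hI hk hkn) = LinearMap.range (h.ι hJ hk hkn) := by
  ext x
  constructor
  · exact fun hx => h.exists_ι_eq hI hJ hk hkn x hx
  · rintro ⟨w, rfl⟩
    exact h.π_ι hI hJ hk hkn w

/-- The family of the restriction to `L_J` of a homomorphism from the projective cover. -/
theorem familyOf_comp_ι {C : Finset (ZMod n)} {hC : C.card = k}
    (r : projAt hk hkn p × projAt hk hkn q →ₗ[B k n] rankOne C hC hk hkn) (i : ZMod n) :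
    familyOf (r ∘ₗ h.ι hJ hk hkn) i =
      familyOf (r ∘ₗ LinearMap.inl _ _ _) i * PowerSeries.X ^ dq i -
        familyOf (r ∘ₗ LinearMap.inr _ _ _) i * PowerSeries.X ^ dp i := by
  have h1 : r ∘ₗ h.ι hJ hk hkn =
      (r ∘ₗ LinearMap.inl _ _ _) ∘ₗ homOfFamily h.degq'.isFamily -
        (r ∘ₗ LinearMap.inr _ _ _) ∘ₗ homOfFamily h.degp'.isFamily := by
    refine LinearMap.ext fun w => ?_
    rw [LinearMap.sub_apply]
    simp only [LinearMap.comp_apply, ← map_sub, ι]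
    congr 1
    simp
  have h2 : ∀ φ ψ : rankOne J hJ hk hkn →ₗ[B k n] rankOne C hC hk hkn,
      familyOf (φ - ψ) i = familyOf φ i - familyOf ψ i := fun _ _ => rfl
  rw [h1, h2, familyOf_comp, familyOf_comp, familyOf_homOfFamily, familyOf_homOfFamily]

/-- An endomorphism of `L_J` that factors through the projective cover of `L_I` is divisible by a
power of `t`. -/
theorem X_pow_dvd_familyOf_comp_ι
    (r : projAt hk hkn p × projAt hk hkn q →ₗ[B k n] rankOne J hJ hk hkn) (i : ZMod n) :
    PowerSeries.X ^ min (dp q) (dq p) ∣ familyOf (r ∘ₗ h.ι hJ hk hkn) i := by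
  rw [familyOf_comp_ι]
  refine dvd_sub ?_ ?_
  -- This composite is an endomorphism of `L_J`, so its family is constant and may be evaluated at
  -- `p`, where the exponent `dq` is largest. The other composite is evaluated at `q`.
  · rw [mul_comm, (h.degq'.isFamily.mul (isFamily_familyOf
      (r ∘ₗ LinearMap.inl _ _ _))).const i p |> (mul_comm _ _).trans]
    exact Dvd.dvd.mul_left (pow_dvd_pow _ (min_le_right _ _)) _
  · rw [mul_comm, (h.degp'.isFamily.mul (isFamily_familyOf
      (r ∘ₗ LinearMap.inr _ _ _))).const i q |> (mul_comm _ _).trans]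
    exact Dvd.dvd.mul_left (pow_dvd_pow _ (min_le_left _ _)) _

/-- The endomorphism `r ι` of `L_J` is divisible by `t`, so `1 + r ι` is invertible. A preimage of
`y` under `1 + ι r` is then `y - ι w` with `(1 + r ι) w = r y`. -/
theorem id_add_surjective (r : projAt hk hkn p × projAt hk hkn q →ₗ[B k n] rankOne J hJ hk hkn) :
    Function.Surjective fun x => x + h.ι hJ hk hkn (r x) := by
  intro y
  have h1 : ∀ i, PowerSeries.X ∣ familyOf (r ∘ₗ h.ι hJ hk hkn) i := fun i =>
    (dvd_pow_self _ (lt_min h.posp h.posq).ne').trans (h.X_pow_dvd_familyOf_comp_ι hJ hk hkn r i)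
  have h2 : ∀ i, IsUnit (1 + familyOf (r ∘ₗ h.ι hJ hk hkn) i) := fun i => by
    rw [PowerSeries.isUnit_iff_constantCoeff, map_add, PowerSeries.X_dvd_iff.1 (h1 i)]
    simp
  have h3 : ∃ w, w + r (h.ι hJ hk hkn w) = r y := by
    choose u hu using fun i => (h2 i).exists_right_inv
    refine ⟨(toLattice J hJ hk hkn).symm fun i => u i * toLattice J hJ hk hkn (r y) i, ?_⟩
    refine (toLattice J hJ hk hkn).injective (funext fun i => ?_)
    have h4 := congrFun (toLattice_hom_apply (r ∘ₗ h.ι hJ hk hkn)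
      ((toLattice J hJ hk hkn).symm fun i => u i * toLattice J hJ hk hkn (r y) i)) i
    rw [LinearMap.comp_apply, AddEquiv.apply_symm_apply, diag_apply] at h4
    rw [map_add, Pi.add_apply, h4, AddEquiv.apply_symm_apply]
    linear_combination toLattice J hJ hk hkn (r y) i * hu i
  obtain ⟨w, hw⟩ := h3
  refine ⟨y - h.ι hJ hk hkn w, ?_⟩
  simp only
  rw [map_sub, ← hw, add_sub_cancel_right, sub_add_cancel]

/-- For superfluity, let `N` and the kernel span the projective. Lifting `π` through its restriction
to `N` gives an endomorphism with image in `N` that differs from the identity by a map into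
`ι(L_J)`. By `id_add_surjective` it is onto, so `N` is everything. -/
theorem isProjectiveCover :
    IsProjectiveCover (linearHom (h.π hI hk hkn) : proj hk hkn p q ⟶ rankOne I hI hk hkn) := by
  have hJ : J.card = k := by rw [h.degq'.card_eq, card_interval p hkn.le]
  refine ⟨inferInstanceAs (Module.Projective (B k n) (projAt hk hkn p × projAt hk hkn q)),
    h.π_surjective hI hk hkn, fun N hN => ?_⟩
  change Submodule (B k n) (projAt hk hkn p × projAt hk hkn q) at N
  change N ⊔ LinearMap.ker (h.π hI hk hkn) = ⊤ at hN
  have hsurj : Function.Surjective (h.π hI hk hkn ∘ₗ N.subtype) := by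
    intro y
    obtain ⟨x, rfl⟩ := h.π_surjective hI hk hkn y
    obtain ⟨u, hu, v, hv, rfl⟩ := Submodule.mem_sup.1 (hN ▸ Submodule.mem_top : x ∈ N ⊔ _)
    refine ⟨⟨u, hu⟩, ?_⟩
    rw [map_add, LinearMap.mem_ker.1 hv, add_zero]
    rfl
  obtain ⟨g, hg⟩ := Module.projective_lifting_property _ (h.π hI hk hkn) hsurj
  let e := LinearEquiv.ofInjective (h.ι hJ hk hkn) (h.ι_injective hJ hk hkn)
  let δ : projAt hk hkn p × projAt hk hkn q →ₗ[B k n] projAt hk hkn p × projAt hk hkn q :=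
    N.subtype ∘ₗ g - LinearMap.id
  have hmem : ∀ x, δ x ∈ LinearMap.range (h.ι hJ hk hkn) := by
    intro x
    rw [← h.ker_π hI hJ hk hkn, LinearMap.mem_ker, LinearMap.sub_apply, map_sub, sub_eq_zero]
    exact LinearMap.congr_fun hg x
  let r := e.symm.toLinearMap ∘ₗ LinearMap.codRestrict _ δ hmem
  have hr : ∀ x, x + h.ι hJ hk hkn (r x) = g x := by
    intro x
    have : h.ι hJ hk hkn (r x) = g x - x :=
      congrArg Subtype.val (e.apply_symm_apply (LinearMap.codRestrict _ δ hmem x))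
    rw [this, add_sub_cancel]
  refine eq_top_iff.2 fun y _ => ?_
  obtain ⟨x, hx⟩ := h.id_add_surjective hJ hk hkn r y
  simp only [hr] at hx
  rw [← hx]
  exact (g x).2

/-- The short exact sequence `0 → L_J → B eₚ ⊕ B e_q → L_I → 0`. -/
def shortComplex : ShortComplex (ModuleCat.{0} (B k n)) :=
  ShortComplex.mk (X₁ := rankOne J hJ hk hkn) (X₂ := proj hk hkn p q) (X₃ := rankOne I hI hk hkn)
    (linearHom (h.ι hJ hk hkn)) (linearHom (h.π hI hk hkn))
    (ModuleCat.hom_ext (LinearMap.ext fun w => h.π_ι hI hJ hk hkn w))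

theorem shortExact : (h.shortComplex hI hJ hk hkn).ShortExact where
  exact := (ShortComplex.ShortExact.moduleCat_exact_iff_function_exact _).2
    (LinearMap.exact_iff.2 (h.ker_π hI hJ hk hkn))
  mono_f := (ModuleCat.mono_iff_injective _).2 (h.ι_injective hJ hk hkn)
  epi_g := (ModuleCat.epi_iff_surjective _).2 (h.π_surjective hI hk hkn)

instance projective_X₂ : Projective (h.shortComplex hI hJ hk hkn).X₂ :=
  projective_moduleCat _
    (inferInstanceAs (Module.Projective (B k n) (projAt hk hkn p × projAt hk hkn q)))

theorem isSyzygy_iff (h : IsResolution k I J p q dp dq)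
    (W : ModuleCat.{0} (B k n)) :
    IsSyzygy (rankOne I hI hk hkn) W ↔ Nonempty (W ≃ₗ[B k n] rankOne J hJ hk hkn) := by
  let e : rankOne J hJ hk hkn ≃ₗ[B k n] LinearMap.ker (h.π hI hk hkn) :=
    (LinearEquiv.ofInjective (h.ι hJ hk hkn) (h.ι_injective hJ hk hkn)).trans
      (LinearEquiv.ofEq _ _ (h.ker_π hI hJ hk hkn).symm)
  constructor
  · rintro ⟨P, π', hπ', ⟨f⟩⟩
    obtain ⟨g⟩ := hπ'.nonempty_ker_equiv (h.isProjectiveCover hI hk hkn)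
    exact ⟨f.trans (g.trans e.symm)⟩
  · rintro ⟨f⟩
    exact ⟨_, _, h.isProjectiveCover hI hk hkn, ⟨f.trans e⟩⟩

/-- Some powers of `t` factor through a projective module. -/
theorem X_pow_smul_ext_eq_zero (h : IsResolution k I J p q dp dq)
    {N : ModuleCat.{0} (B k n)}
    (x : Abelian.Ext.{0} (rankOne I hI hk hkn) N 1) :
    (PowerSeries.X ^ min (dp q) (dq p) : ℂ⟦X⟧) • x = 0 := by
  have key : ∀ {s : ZMod n} {e : ZMod n → ℕ} {m : ℕ}, IsDegree (interval s k) I e →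
      (∀ i, e i ≤ m) → (PowerSeries.X ^ m : ℂ⟦X⟧) • x = 0 := by
    intro s e m hdeg hle
    -- The complementary exponents give a map back to the projective, and the composite is
    -- multiplication by `t ^ m`. Here `e i ≤ m` keeps the subtraction exact.
    have hdeg' : IsDegree I (interval s k) (fun i => m - e i) := by
      intro i
      have h1 := hdeg i
      have h2 := hle i
      have h3 := hle (i - 1)
      simp only
      omega
    have : Projective (projAt hk hkn s) :=
      projective_moduleCat _ (projective_projAt hk hkn s)
    let α : rankOne I hI hk hkn ⟶ projAt hk hkn s := linearHom (homOfFamily hdeg'.isFamily)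
    let β : projAt hk hkn s ⟶ rankOne I hI hk hkn := linearHom (homOfFamily hdeg.isFamily)
    have hαβ : α ≫ β = (PowerSeries.X ^ m : ℂ⟦X⟧) • 𝟙 (rankOne I hI hk hkn) := by
      refine rankOne_hom_ext fun i => ?_
      rw [familyOf_smul, ModuleCat.hom_id, familyOf_id, ModuleCat.hom_comp, familyOf_comp]
      change familyOf (homOfFamily hdeg.isFamily) i * familyOf (homOfFamily hdeg'.isFamily) i = _
      rw [familyOf_homOfFamily, familyOf_homOfFamily, mul_one, ← pow_add,
        Nat.add_sub_cancel' (hle i)]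
    exact smul_ext_eq_zero _ α β hαβ x
  rcases min_choice (dp q) (dq p) with h1 | h1
  · rw [h1]
    exact key h.degp h.lep
  · rw [h1]
    exact key h.degq h.leq

theorem nonempty_ext_equiv (h : IsResolution k I J p q dp dq) :
    Nonempty (Abelian.Ext.{0} (rankOne I hI hk hkn) (rankOne J hJ hk hkn) 1 ≃ₗ[ℂ⟦X⟧]
      ℂ⟦X⟧ ⧸ Ideal.span {(PowerSeries.X : ℂ⟦X⟧) ^ min (dp q) (dq p)}) := by
  have hd : IsDegree J J (fun _ => 0) := fun i => rfl
  let f₀ : rankOne J hJ hk hkn ⟶ rankOne J hJ hk hkn := linearHom (homOfFamily hd.isFamily)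
  refine ⟨extEquivQuotient (h.shortExact hI hJ hk hkn) f₀
    (exists_smul_of_isDegree hd (i₀ := 0) rfl) _ (le_antisymm (fun z hz => ?_) ?_)⟩
  · obtain ⟨g, hg⟩ := (connecting_eq_zero_iff _ _ _).1 hz
    let g' : projAt hk hkn p × projAt hk hkn q →ₗ[B k n] rankOne J hJ hk hkn := g.hom
    have h1 := h.X_pow_dvd_familyOf_comp_ι hJ hk hkn g' 0
    have h2 : g' ∘ₗ h.ι hJ hk hkn = (z • f₀).hom := congrArg ModuleCat.Hom.hom hg
    rw [h2, familyOf_smul, hom_linearHom, familyOf_homOfFamily, pow_zero, mul_one] at h1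
    exact Ideal.mem_span_singleton.2 h1
  · rw [Ideal.span_singleton_le_iff_mem]
    exact h.X_pow_smul_ext_eq_zero hI hk hkn _

/-- If `t` factors through a projective module and the homomorphisms from `B eₚ` and `B e_q` to
`L_C` are divisible by `t` away from `p` and `q`, then `Ext¹` is one-dimensional. -/
theorem nonempty_ext_equiv_of_eq_one (h : IsResolution k I J p q dp dq)
    (hJ : J.card = k) (h1 : min (dp q) (dq p) = 1)
    {C : Finset (ZMod n)} (hC : C.card = k)
    (hp : ∀ g, IsFamily (interval p k) C g → ∀ i, i ≠ p → PowerSeries.X ∣ g i)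
    (hq : ∀ g, IsFamily (interval q k) C g → ∀ i, i ≠ q → PowerSeries.X ∣ g i) :
    Nonempty (Abelian.Ext.{0} (rankOne I hI hk hkn) (rankOne C hC hk hkn) 1 ≃ₗ[ℂ⟦X⟧]
      ℂ⟦X⟧ ⧸ Ideal.span {(PowerSeries.X : ℂ⟦X⟧)}) := by
  obtain ⟨d, hd, i₀, hi₀⟩ := exists_isDegree (hJ.trans hC.symm)
  let f₀ : rankOne J hJ hk hkn ⟶ rankOne C hC hk hkn := linearHom (homOfFamily hd.isFamily)
  refine ⟨extEquivQuotient (h.shortExact hI hJ hk hkn) f₀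
    (exists_smul_of_isDegree hd hi₀) _ (le_antisymm (fun z hz => ?_) ?_)⟩
  · obtain ⟨g, hg⟩ := (connecting_eq_zero_iff _ _ _).1 hz
    let g' : projAt hk hkn p × projAt hk hkn q →ₗ[B k n] rankOne C hC hk hkn := g.hom
    have h2 : g' ∘ₗ h.ι hJ hk hkn = (z • f₀).hom := congrArg ModuleCat.Hom.hom hg
    have h3 := h.familyOf_comp_ι hJ hk hkn g' i₀
    rw [h2, familyOf_smul, hom_linearHom, familyOf_homOfFamily, hi₀, pow_zero, mul_one] at h3
    rw [Ideal.mem_span_singleton, h3]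
    -- At the vertex `i₀` where `f₀` has exponent zero, `z` is a difference of two products. Away
    -- from the peak the map from the projective supplies a factor `t`; at the peak the exponent of
    -- the inclusion does.
    refine dvd_sub ?_ ?_
    · by_cases hi : i₀ = p
      · rw [hi]
        exact Dvd.dvd.mul_left (dvd_pow_self _ h.posq.ne') _
      · exact Dvd.dvd.mul_right (hp _ (isFamily_familyOf _) _ hi) _
    · by_cases hi : i₀ = q
      · rw [hi]
        exact Dvd.dvd.mul_left (dvd_pow_self _ h.posp.ne') _
      · exact Dvd.dvd.mul_right (hq _ (isFamily_familyOf _) _ hi) _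
  · rw [Ideal.span_singleton_le_iff_mem, LinearMap.mem_ker]
    have := h.X_pow_smul_ext_eq_zero hI hk hkn (N := rankOne C hC hk hkn)
    rw [h1, pow_one] at this
    exact this _

end IsResolution

/-- The residue field as a quotient of the ring of power series. -/
theorem exists_addEquiv_of_quotient_X {M : Type*} [AddCommGroup M] [Module ℂ⟦X⟧ M]
    (e : M ≃ₗ[ℂ⟦X⟧] ℂ⟦X⟧ ⧸ Ideal.span {(PowerSeries.X : ℂ⟦X⟧)}) :
    ∃ e : M ≃+ ℂ, ∀ (f : ℂ⟦X⟧) (u : M), e (f • u) = PowerSeries.constantCoeff f * e u := by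
  have hker : RingHom.ker (PowerSeries.constantCoeff (R := ℂ)) =
      Ideal.span {(PowerSeries.X : ℂ⟦X⟧)} := by
    ext f
    rw [RingHom.mem_ker, Ideal.mem_span_singleton, PowerSeries.X_dvd_iff]
  have hsurj : Function.Surjective (PowerSeries.constantCoeff (R := ℂ)) :=
    fun c => ⟨PowerSeries.C c, by simp⟩
  let e' : (ℂ⟦X⟧ ⧸ Ideal.span {(PowerSeries.X : ℂ⟦X⟧)}) ≃+* ℂ :=
    (Ideal.quotEquivOfEq hker.symm).trans (RingHom.quotientKerEquivOfSurjective hsurj)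
  refine ⟨e.toAddEquiv.trans e'.toAddEquiv, fun f u => ?_⟩
  change e' (e (f • u)) = _ * e' (e u)
  rw [e.map_smul]
  obtain ⟨y, hy⟩ := Ideal.Quotient.mk_surjective (e u)
  rw [← hy]
  exact map_mul PowerSeries.constantCoeff f y

end CircularAlgebra
end

/-! ### The main theorem -/

open CircularAlgebra
theorem proposition3p6 (k n : ℕ) [NeZero n] (hk : 1 < k) (hkn : 2 * k ≤ n)
    (I : Finset (ZMod n)) (hI : I.card = k) (hpeaks : (peaks I).card = 2) :
    (∃ W : ModuleCat.{0} (B k n), IsSyzygy (rankOne I hI (by omega) (by omega)) W) ∧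
    ∀ W : ModuleCat.{0} (B k n), IsSyzygy (rankOne I hI (by omega) (by omega)) W →
      Nonempty (Abelian.Ext (rankOne I hI (by omega) (by omega)) W 1 ≃ₗ[ℂ⟦X⟧]
        ℂ⟦X⟧ ⧸ Ideal.span {(PowerSeries.X : ℂ⟦X⟧) ^ minSlope I}) ∧
      (1 ∈ slopeLengths I →
        (∃ e : Abelian.Ext (rankOne I hI (by omega) (by omega)) W 1 ≃+ ℂ,
          ∀ (f : ℂ⟦X⟧) (u), e (f • u) = PowerSeries.constantCoeff f * e u) ∧
        (∃ e : Abelian.Ext W (rankOne I hI (by omega) (by omega)) 1 ≃+ ℂ,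
          ∀ (f : ℂ⟦X⟧) (u), e (f • u) = PowerSeries.constantCoeff f * e u)) := by
  obtain ⟨p, a, b, c, d, h⟩ := exists_isTwoPeak hpeaks
  have h0 : 0 < k := by omega
  have h0n : k < n := by omega
  have hsum := h.sum
  have hTJ : IsTwoPeak (twoPeak (p + (a : ZMod n)) c b a) (p + (a : ZMod n)) c b a d :=
    isTwoPeak_twoPeak _ h.hc h.hb h.ha h.hd (by omega)
  have hTK : IsTwoPeak (twoPeak (p + (a : ZMod n) + (c : ZMod n)) a b c)
      (p + (a : ZMod n) + (c : ZMod n)) a b c d :=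
    isTwoPeak_twoPeak _ h.ha h.hb h.hc h.hd hsum
  -- `J` and `K` are the rims of the first and second syzygies of `L_I`; from here on only their
  -- slope data matter.
  generalize twoPeak (p + (a : ZMod n)) c b a = J at hTJ
  generalize twoPeak (p + (a : ZMod n) + (c : ZMod n)) a b c = K at hTK
  have hkac : k = a + c := by rw [← hI, h.card_eq]
  have hJ : J.card = k := by rw [hTJ.card_eq, hkac, add_comm]
  have hK : K.card = k := by rw [hTK.card_eq, hkac]
  have hrI := h.isResolution hTJ hI
  have hrJ := hTJ.isResolution hTK hJ
  have hp : p + ((a + b : ℕ) : ZMod n) + ((c + d : ℕ) : ZMod n) = p := by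
    rw [add_add_natCast, show a + b + (c + d) = n by omega, ZMod.natCast_self, add_zero]
  have hpJ : p + (a : ZMod n) + ((c + b : ℕ) : ZMod n) + ((a + d : ℕ) : ZMod n) =
      p + (a : ZMod n) := by
    rw [add_add_natCast _ (c + b), show c + b + (a + d) = n by omega, ZMod.natCast_self, add_zero]
  have hm : min (degPeak p a b c (p + ((a + b : ℕ) : ZMod n)))
      (degPeak (p + ((a + b : ℕ) : ZMod n)) c d a p) = minSlope I := by
    have := h.rotate.degPeak_peak
    rw [hp] at this
    rw [h.degPeak_peak, this, h.minSlope_eq]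
  have hmJ : min (degPeak (p + (a : ZMod n)) c b a (p + (a : ZMod n) + ((c + b : ℕ) : ZMod n)))
      (degPeak (p + (a : ZMod n) + ((c + b : ℕ) : ZMod n)) a d c (p + (a : ZMod n))) =
        minSlope I := by
    have := hTJ.rotate.degPeak_peak
    rw [hpJ] at this
    rw [hTJ.degPeak_peak, this, h.minSlope_eq]
    omega
  refine ⟨⟨_, (hrI.isSyzygy_iff hI hJ h0 h0n _).2 ⟨LinearEquiv.refl _ _⟩⟩, fun W hW => ?_⟩
  obtain ⟨f⟩ := (hrI.isSyzygy_iff hI hJ h0 h0n W).1 hW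
  obtain ⟨e⟩ := hrI.nonempty_ext_equiv hI hJ h0 h0n
  rw [hm] at e
  let e₁ := (extCongrRight ℂ⟦X⟧ (rankOne I hI h0 h0n) f.toModuleIso 1).trans e
  refine ⟨⟨e₁⟩, fun hone => ?_⟩
  have hmin : minSlope I = 1 := by
    rw [h.minSlope_eq]
    rw [h.slopeLengths_eq] at hone
    simp only [Set.mem_insert_iff, Set.mem_singleton_iff] at hone
    have := h.ha
    have := h.hb
    have := h.hc
    have := h.hd
    omega
  -- The peaks of `J` are the valleys of `I`, so the divisibility away from the valleys supplies
  -- both required hypotheses, the second one after rotating `I`.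
  obtain ⟨e'⟩ := hrJ.nonempty_ext_equiv_of_eq_one hJ h0 h0n hK (hmJ.trans hmin) hI
    (fun g hg i hi => h.X_dvd_of_isFamily h0 h0n hg hi) (fun g hg i hi => by
      have hv : p + (a : ZMod n) + ((c + b : ℕ) : ZMod n) =
          p + ((a + b : ℕ) : ZMod n) + (c : ZMod n) := by
        push_cast
        ring
      rw [hv] at hg hi
      exact h.rotate.X_dvd_of_isFamily h0 h0n hg hi)
  rw [hmin, pow_one] at e₁
  exact ⟨exists_addEquiv_of_quotient_X e₁, exists_addEquiv_of_quotient_X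
    ((extCongrLeft ℂ⟦X⟧ (rankOne I hI h0 h0n) f.toModuleIso 1).trans e')⟩
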